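/- Let $d\ge 1$ and let $\mathfrak h=L^2(\mathbb R^d;\mathbb C^\nu)$, with $\nu=1$ (Schrödinger case) or $\nu=2$ (Pauli case). Let $U:\mathbb R^d\to\mathbb R$ be measurable with $U_+=\max(U,0)\in L^1_{\rm loc}(\mathbb R^d)$, and suppose that $U_-=\max(-U,0)$ is form bounded with respect to $-\Delta$ with relative bound less than one: there are $a\in(0,1)$ and $b\in\mathbb R$ with $\langle\psi,U_-\psi\rangle\le a\langle\psi,-\Delta\psi\rangle+b\|\psi\|^2$ for all $\psi\in H^1(\mathbb R^d)$. Let $\mathcal Q=H^1(\mathbb R^d;\mathbb C^\nu)\cap L^2(\mathbb R^d,U_+\,dx;\mathbb C^\nu)$ be the form domain of $-\Delta+U$. For $n\in\mathbb N\cup\{\infty\}$ let $H_n=-\Delta+U+V_n$ as a quadratic form on $\mathcal Q$, where * in the Schrödinger case $V_n=W_n$; * in the Pauli case $V_n=W_n+A_n\cdot\nabla+\sigma\cdot B_n$, with $\sigma=(\sigma_1,\sigma_2,\sigma_3)$ the Pauli matrices and $\nabla\cdot A_n=A_n\cdot\nabla$, that is, $\operatorname{div}A_n=0$ in the sense of distributions.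 Here $W_n:\mathbb R^d\to\mathbb R$ and $B_n:\mathbb R^d\to\mathbb R^3$ are measurable and locally integrable, and $A_n:\mathbb R^d\to\mathbb C^d$ is measurable. (Both real $A_n$ and $A_n=-i\,a_n$ with $a_n$ real are included; in the latter case $A_n\cdot\nabla=a_n\cdot(-i\nabla)$ and $H_n$ is symmetric. In general $H_n$ need not be symmetric, hence the real parts below; they can be dropped when it is.) Suppose that for some $0<\delta<\tfrac12$, $\lambda_0>0$ and $C$, for all $n\in\mathbb N\cup\{\infty\}$ and $1\le j\le 3$, $$\|(-\Delta+\lambda_0)^{-\delta}W_n(-\Delta+\lambda_0)^{-\delta}\|\le C,\quad \|A_n(-\Delta+\lambda_0)^{-\delta}\|\le C,\quad \|(-\Delta+\lambda_0)^{-\delta}(B_n)_j(-\Delta+\lambda_0)^{-\delta}\|\le C$$ as operators on $L^2$ (only the first bound in the Schrödinger case). The forms of $W_n$ and $(B_n)_j$, given by $\int W_n\bar\phi\psi$ and $\int (B_n)_j\bar\phi\psi$ on $C_c^\infty$, are thereby extended by continuity to $H^1$, hence to $\mathcal Q$. Suppose moreover that $V_n\to V_\infty$ weakly on $\mathcal Q$: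 $\lim_{n\to\infty}\langle\phi,V_n\psi\rangle=\langle\phi,V_\infty\psi\rangle$ for all $\phi,\psi\in\mathcal Q$. Then there is $m\in\mathbb R$ with $\operatorname{Re}\langle\psi,H_n\psi\rangle\ge m\|\psi\|^2$ for all $\psi\in\mathcal Q$ and all $n\in\mathbb N\cup\{\infty\}$. For every such $m$, every $\lambda>\max(-m,\lambda_0)$ and every sequence $(\psi_n)_{n\in\mathbb N}\subset\mathcal Q$ that converges weakly in $L^2$ to some $\psi\in\mathcal Q$, $$\liminf_{n\to\infty}\operatorname{Re}\langle\psi_n,(H_n+\lambda)\psi_n\rangle\ \ge\ \operatorname{Re}\langle\psi,(H_\infty+\lambda)\psi\rangle .$$ -/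

import Mathlib

open MeasureTheory Filter Topology
open scoped FourierTransform SchwartzMap

noncomputable section

namespace WeakGamma

/-- Configuration space `ℝ^d` with its Euclidean norm and Lebesgue measure. -/
abbrev X (d : ℕ) : Type := EuclideanSpace ℝ (Fin d)

/-- The Hilbert space `L²(ℝ^d; F)`; `F = ℂ` for Schrödinger and `F = ℂ²` for Pauli operators. -/
abbrev L2 (d : ℕ) (F : Type) [NormedAddCommGroup F] [InnerProductSpace ℂ F] : Type :=
  Lp (α := X d) F 2 volume

/-- The spin space `ℂ²`. -/
abbrev Spin : Type := EuclideanSpace ℂ (Fin 2)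

section General

variable {d : ℕ} {F : Type} [NormedAddCommGroup F] [InnerProductSpace ℂ F] [CompleteSpace F]

/-- The Sobolev space `H¹(ℝ^d; F)`, as a set of `L²` functions. -/
def IsH1 (ψ : L2 d F) : Prop :=
  TemperedDistribution.MemSobolev 1 2 (ψ : 𝓢'(X d, F))

/-- `ψ` has a smooth compactly supported representative. -/
def IsTest (ψ : L2 d F) : Prop :=
  ∃ g : X d → F, ContDiff ℝ (⊤ : ℕ∞) g ∧ HasCompactSupport g ∧ (ψ : X d → F) =ᵐ[volume] g

open Classical in
/-- The Fourier multiplier `𝓕⁻¹ m 𝓕` on `L²`, with its maximal domain (and the value `0` outside).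
Recall that `𝓕 f ξ = ∫ exp(-2πi x·ξ) f(x) dx`. -/
def mult (m : X d → ℂ) (ψ : L2 d F) : L2 d F :=
  if h : MemLp (fun ξ => m ξ • (𝓕 ψ : L2 d F) ξ) 2 volume then 𝓕⁻ (h.toLp _) else 0

/-- The partial derivative `∂ⱼψ` of `ψ ∈ H¹`. -/
def partialD (j : Fin d) (ψ : L2 d F) : L2 d F :=
  mult (fun ξ => 2 * Real.pi * Complex.I * (ξ j : ℂ)) ψ

/-- The power `(-Δ + lam)^s ψ`. -/
def lapPow (lam s : ℝ) (ψ : L2 d F) : L2 d F :=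
  mult (fun ξ => (((4 * Real.pi ^ 2 * ‖ξ‖ ^ 2 + lam) ^ s : ℝ) : ℂ)) ψ

/-- The form domain `Q = H¹ ∩ L²(U₊ dx)` of `-Δ + U`. -/
def InQ (U : X d → ℝ) (ψ : L2 d F) : Prop :=
  IsH1 ψ ∧ Integrable (fun x => max (U x) 0 * ‖ψ x‖ ^ 2) volume

/-- The sesquilinear form `⟨φ, (-Δ + U) ψ⟩`. -/
def freeForm (U : X d → ℝ) (φ ψ : L2 d F) : ℂ :=
  (∑ j : Fin d, inner ℂ (partialD j φ) (partialD j ψ)) +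
    ∫ x, (U x : ℂ) * inner ℂ (φ x) (ψ x)

/-- The bounded operator `T` is the (closure of the) operator
`(-Δ + lam)^(-δ) w (-Δ + lam)^(-δ)`, with `w` acting by multiplication: for all test functions,
`⟨(-Δ + lam)^δ φ, T (-Δ + lam)^δ ψ⟩ = ∫ w φ̄ ψ`. -/
def IsSandwich (lam δ : ℝ) (w : X d → ℝ) (T : L2 d F →L[ℂ] L2 d F) : Prop :=
  ∀ φ ψ : L2 d F, IsTest φ → IsTest ψ →
    inner ℂ (lapPow lam δ φ) (T (lapPow lam δ ψ)) = ∫ x, (w x : ℂ) * inner ℂ (φ x) (ψ x)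

open Classical in
/-- The operator `(-Δ + lam)^(-δ) w (-Δ + lam)^(-δ)` on `L²(ℝ^d; F)` when it is bounded. It is
unique then, as `(-Δ + lam)^δ` maps the test functions onto a dense subspace. -/
def sandwich (lam δ : ℝ) (w : X d → ℝ) : L2 d F →L[ℂ] L2 d F :=
  if h : ∃ T : L2 d F →L[ℂ] L2 d F, IsSandwich lam δ w T then h.choose else 0

variable (F) in
/-- `w` is a measurable function that has a form on the test functions, and
`‖(-Δ + lam)^(-δ) w (-Δ + lam)^(-δ)‖ ≤ C` on `L²(ℝ^d; F)`. -/
def SandwichBound (lam δ C : ℝ) (w : X d → ℝ) : Prop :=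
  Measurable w ∧ LocallyIntegrable w volume ∧
    (∃ T : L2 d F →L[ℂ] L2 d F, IsSandwich lam δ w T) ∧
    ‖(sandwich lam δ w : L2 d F →L[ℂ] L2 d F)‖ ≤ C

/-- The form `⟨φ, w ψ⟩` of a potential `w`, extended by continuity from the test functions to the
form domain of `(-Δ + lam)^(2δ)`, which contains `H¹` if `δ ≤ 1/2`. -/
def potForm (lam δ : ℝ) (w : X d → ℝ) (φ ψ : L2 d F) : ℂ :=
  inner ℂ (lapPow lam δ φ) (sandwich lam δ w (lapPow lam δ ψ))

variable (F) in
/-- `‖A (-Δ + lam)^(-δ)‖ ≤ C` as an operator from `L²(ℝ^d; F)` to `L²(ℝ^d; ℂ^d ⊗ F)`,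
with `A` measurable. -/
def VectorBound (lam δ C : ℝ) (A : X d → EuclideanSpace ℂ (Fin d)) : Prop :=
  Measurable A ∧ ∀ f : L2 d F,
    eLpNorm (fun x => ‖A x‖ * ‖lapPow lam (-δ) f x‖) 2 volume ≤ ENNReal.ofReal (C * ‖f‖)

/-- `∇·A = A·∇` as operators, that is, `div A = 0` in the sense of distributions. -/
def DivFree (A : X d → EuclideanSpace ℂ (Fin d)) : Prop :=
  ∀ f : X d → ℂ, ContDiff ℝ (⊤ : ℕ∞) f → HasCompactSupport f →
    ∫ x, ∑ j : Fin d, A x j * fderiv ℝ f x (EuclideanSpace.single j 1) = 0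

/-- The form `⟨φ, A·∇ψ⟩`. -/
def driftForm (A : X d → EuclideanSpace ℂ (Fin d)) (φ ψ : L2 d F) : ℂ :=
  ∑ j : Fin d, ∫ x, A x j * inner ℂ (φ x) (partialD j ψ x)

/-- `V_n → V_∞` weakly on `Q`, where `v n φ ψ = ⟨φ, V_n ψ⟩`. -/
def WeakConv (U : X d → ℝ) (v : ℕ∞ → L2 d F → L2 d F → ℂ) : Prop :=
  ∀ φ ψ : L2 d F, InQ U φ → InQ U ψ →
    Tendsto (fun n : ℕ => v (n : ℕ∞) φ ψ) atTop (𝓝 (v ⊤ φ ψ))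

/-- The energy `Re ⟨ψ, (H_n + lam) ψ⟩` for `H_n = -Δ + U + V_n` and `v n φ ψ = ⟨φ, V_n ψ⟩`. -/
def energy (U : X d → ℝ) (v : ℕ∞ → L2 d F → L2 d F → ℂ) (lam : ℝ) (n : ℕ∞) (ψ : L2 d F) : ℝ :=
  (freeForm U ψ ψ + v n ψ ψ).re + lam * ‖ψ‖ ^ 2

/-- `m` is a lower bound of all `H_n`, `n ∈ ℕ ∪ {∞}`. -/
def IsLowerBound (U : X d → ℝ) (v : ℕ∞ → L2 d F → L2 d F → ℂ) (m : ℝ) : Prop :=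
  ∀ (n : ℕ∞) (ψ : L2 d F), InQ U ψ → m * ‖ψ‖ ^ 2 ≤ energy U v 0 n ψ

/-- The `H_n`, `n ∈ ℕ ∪ {∞}`, have a common lower bound and, for every such bound `m` and every
`lam > max (-m) lam₀`, the weak `Γ`-lower bound holds for `H_n + lam`. -/
def WeakGammaLowerBound (U : X d → ℝ) (v : ℕ∞ → L2 d F → L2 d F → ℂ) (lam₀ : ℝ) : Prop :=
  (∃ m : ℝ, IsLowerBound U v m) ∧
  ∀ m : ℝ, IsLowerBound U v m → ∀ lam : ℝ, max (-m) lam₀ < lam →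
    ∀ (Ψ : ℕ → L2 d F) (ψ : L2 d F), (∀ n, InQ U (Ψ n)) → InQ U ψ →
      (∀ φ : L2 d F, Tendsto (fun n => inner ℂ φ (Ψ n)) atTop (𝓝 (inner ℂ φ ψ))) →
      ((energy U v lam ⊤ ψ : ℝ) : EReal) ≤
        liminf (fun n : ℕ => ((energy U v lam (n : ℕ∞) (Ψ n) : ℝ) : EReal)) atTop

end General

/-- The assumption on the external potential: `U₊ ∈ L¹_loc` and `U₋` is form bounded with respect
to `-Δ` with relative bound less than one. -/
def AssumptionU {d : ℕ} (U : X d → ℝ) : Prop :=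
  Measurable U ∧ LocallyIntegrable (fun x => max (U x) 0) volume ∧
  ∃ a b : ℝ, 0 < a ∧ a < 1 ∧ ∀ ψ : L2 d ℂ, IsH1 ψ →
    Integrable (fun x => max (-U x) 0 * ‖ψ x‖ ^ 2) volume ∧
    ∫ x, max (-U x) 0 * ‖ψ x‖ ^ 2 ≤ a * ∑ j : Fin d, ‖partialD j ψ‖ ^ 2 + b * ‖ψ‖ ^ 2

/-- The Pauli matrices. -/
def pauli : Fin 3 → Matrix (Fin 2) (Fin 2) ℂ :=
  ![!![0, 1; 1, 0], !![0, -Complex.I; Complex.I, 0], !![1, 0; 0, -1]]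

/-- `σⱼ ψ`. -/
def pauliApply {d : ℕ} (j : Fin 3) (ψ : L2 d Spin) : L2 d Spin :=
  (Matrix.toEuclideanCLM (n := Fin 2) (𝕜 := ℂ) (pauli j)).compLp ψ

/-- The Pauli form `⟨φ, (W + A·∇ + σ·B) ψ⟩`. -/
def pauliForm {d : ℕ} (lam δ : ℝ) (W : X d → ℝ) (A : X d → EuclideanSpace ℂ (Fin d))
    (B : X d → Fin 3 → ℝ) (φ ψ : L2 d Spin) : ℂ :=
  potForm lam δ W φ ψ + driftForm A φ ψ +
    ∑ j : Fin 3, potForm lam δ (fun x => B x j) φ (pauliApply j ψ)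

end WeakGamma

end

open WeakGamma

/-! Write `Ψ n = ψ + χ n` with `χ n` weakly null. The energy of `H_n + λ` at `Ψ n` is its energy at
`χ n`, plus its energy at `ψ`, plus cross terms. The first is nonnegative because `λ > -m`, and the
second tends to the `H_∞` energy by weak convergence of `V_n`, which is needed only on the pair `(ψ,
ψ)`. Hence it suffices that the cross terms vanish along a subsequence of energies bounded above;
the limit of `⟨χ n, V_n χ n⟩` is never needed.

`V_n` has lower order than `-Δ`, so its relative form bound is arbitrarily small, uniformly in `n`.
This gives uniform coercivity (`exists_coercive`), and bounded energy becomes boundedness in `H¹`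
and in `L²(|U| dx)`. The cross term of `-Δ + U` then vanishes by weak convergence
(`tendsto_freeForm`).

The delicate term is `⟨χ n, V_n ψ⟩`, where form and argument vary together
(`AdmissibleForm.tendsto_left`). By density both functions may be taken to be test functions.
Locality allows `χ n` to be multiplied by a cutoff equal to one near the support of `ψ`. The
truncated sequence tends to zero in `L²` by Rellich's argument, and by interpolation in the norm of
`(-Δ + λ₀)^δ`, as `δ < 1/2`. A bound by `‖(-Δ + λ₀)^δ a‖ ‖(-Δ + λ₀)^(1/2) b‖`, uniform in `n`,
finishes the argument.

`AdmissibleForm` collects what this uses. Potentials satisfy it directly. The drift puts a full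
derivative on one function, and `div A = 0` moves it to the other, so the estimate holds in both
slots. -/

noncomputable section

namespace WeakGamma

/-! ### Fourier multipliers on `L²` and the Fourier description of `H¹`. -/

section Multiplier

variable {d : ℕ} {F : Type} [NormedAddCommGroup F] [InnerProductSpace ℂ F]

theorem norm_sq_eq_integral (f : L2 d F) : ‖f‖ ^ 2 = ∫ x, ‖f x‖ ^ 2 := by
  have h := L2.inner_def (𝕜 := ℂ) f f
  rw [inner_self_eq_norm_sq_to_K] at h
  have h2 : ∀ x, inner ℂ (f x) (f x) = ((‖f x‖ ^ 2 : ℝ) : ℂ) := fun x => by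
    rw [inner_self_eq_norm_sq_to_K]; norm_cast
  simp_rw [h2] at h
  rw [integral_complex_ofReal] at h
  exact Complex.ofReal_injective (by push_cast at h ⊢; exact h)

theorem integrable_norm_sq (f : L2 d F) : Integrable (fun x => ‖f x‖ ^ 2) volume := by
  have := (Lp.memLp f).integrable_norm_pow (by norm_num)
  simpa using this

theorem norm_le_of_ae_le {G : Type} [NormedAddCommGroup G] [InnerProductSpace ℂ G]
    (f : L2 d F) (g : L2 d G) (c : ℝ)
    (h : ∀ᵐ x, ‖f x‖ ≤ c * ‖g x‖) : ‖f‖ ≤ c * ‖g‖ :=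
  Lp.norm_le_mul_norm_of_ae_le_mul h

variable [CompleteSpace F]

/-- `ψ` lies in the maximal domain of the Fourier multiplier `m`. -/
def InDom (m : X d → ℂ) (ψ : L2 d F) : Prop :=
  MemLp (fun ξ => m ξ • (𝓕 ψ : L2 d F) ξ) 2 volume

theorem fourier_mult {m : X d → ℂ} {ψ : L2 d F} (h : InDom m ψ) :
    (𝓕 (mult m ψ) : L2 d F) =ᵐ[volume] fun ξ => m ξ • (𝓕 ψ : L2 d F) ξ := by
  have h' : MemLp (fun ξ => m ξ • (𝓕 ψ : L2 d F) ξ) 2 volume := h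
  have : (𝓕 (mult m ψ) : L2 d F) = h'.toLp _ := by
    rw [mult, dif_pos h', FourierTransform.fourier_fourierInv_eq]
  rw [this]
  exact h'.coeFn_toLp

theorem eq_of_fourier_ae {a b : L2 d F}
    (h : (𝓕 a : L2 d F) =ᵐ[volume] (𝓕 b : L2 d F)) : a = b := by
  have h1 : (𝓕 a : L2 d F) = 𝓕 b := Lp.ext h
  rw [← FourierTransform.fourierInv_fourier_eq (F := L2 d F) a, h1,
    FourierTransform.fourierInv_fourier_eq]

/-- No domain condition has to be checked: `φ` is in `L²`, so the identity itself puts `ψ` in the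
domain. Most identities for multipliers below are proved this way. -/
theorem mult_eq_of_ae {m : X d → ℂ} {ψ φ : L2 d F}
    (h : (𝓕 φ : L2 d F) =ᵐ[volume] fun ξ => m ξ • (𝓕 ψ : L2 d F) ξ) : mult m ψ = φ := by
  have hd : InDom m ψ := (Lp.memLp (𝓕 φ : L2 d F)).ae_eq h
  exact eq_of_fourier_ae ((fourier_mult hd).trans h.symm)

theorem fourier_sub_ae (a b : L2 d F) :
    (𝓕 (a - b) : L2 d F) =ᵐ[volume] fun ξ => (𝓕 a : L2 d F) ξ - (𝓕 b : L2 d F) ξ := by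
  have : (𝓕 (a - b) : L2 d F) = 𝓕 a - 𝓕 b :=
    (Lp.fourierTransformₗᵢ (X d) F).map_sub a b
  rw [this]
  exact Lp.coeFn_sub _ _

theorem InDom.sub {m : X d → ℂ} {a b : L2 d F} (ha : InDom m a) (hb : InDom m b) :
    InDom m (a - b) := by
  refine (MemLp.sub ha hb).ae_eq ?_
  filter_upwards [fourier_sub_ae a b] with ξ h
  simp [h, smul_sub]

theorem mult_sub {m : X d → ℂ} {a b : L2 d F} (ha : InDom m a) (hb : InDom m b) :
    mult m (a - b) = mult m a - mult m b := by
  apply mult_eq_of_ae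
  filter_upwards [fourier_sub_ae a b, fourier_sub_ae (mult m a) (mult m b), fourier_mult ha,
    fourier_mult hb] with ξ h1 h2 h3 h4
  rw [h2, h1, h3, h4, smul_sub]

theorem norm_mult_sq {m : X d → ℂ} {a : L2 d F} (ha : InDom m a) :
    ‖mult m a‖ ^ 2 = ∫ ξ, ‖m ξ‖ ^ 2 * ‖(𝓕 a : L2 d F) ξ‖ ^ 2 := by
  rw [← Lp.norm_fourier_eq (mult m a), norm_sq_eq_integral]
  refine integral_congr_ae ?_
  filter_upwards [fourier_mult ha] with ξ h
  rw [h, norm_smul, mul_pow]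

theorem InDom.integrable {m : X d → ℂ} {a : L2 d F} (ha : InDom m a) :
    Integrable (fun ξ => ‖m ξ‖ ^ 2 * ‖(𝓕 a : L2 d F) ξ‖ ^ 2) volume := by
  refine (integrable_norm_sq (𝓕 (mult m a) : L2 d F)).congr ?_
  filter_upwards [fourier_mult ha] with ξ h
  rw [h, norm_smul, mul_pow]

theorem inner_mult {m : X d → ℂ} {a b : L2 d F} (ha : InDom m a) (hb : InDom m b) :
    inner ℂ (mult m a) (mult m b) =
      ∫ ξ, ((‖m ξ‖ ^ 2 : ℝ) : ℂ) * inner ℂ ((𝓕 a : L2 d F) ξ) ((𝓕 b : L2 d F) ξ) := by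
  rw [← Lp.inner_fourier_eq (mult m a) (mult m b), L2.inner_def]
  refine integral_congr_ae ?_
  filter_upwards [fourier_mult ha, fourier_mult hb] with ξ h1 h2
  rw [h1, h2, inner_smul_left, inner_smul_right, ← mul_assoc, mul_comm _ (m ξ), Complex.mul_conj,
    Complex.normSq_eq_norm_sq]

theorem norm_mult_le {m m' : X d → ℂ} {a : L2 d F} {c : ℝ} (ha : InDom m a) (ha' : InDom m' a)
    (h : ∀ ξ, ‖m ξ‖ ≤ c * ‖m' ξ‖) : ‖mult m a‖ ≤ c * ‖mult m' a‖ := by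
  rw [← Lp.norm_fourier_eq (mult m a), ← Lp.norm_fourier_eq (mult m' a)]
  apply norm_le_of_ae_le
  filter_upwards [fourier_mult ha, fourier_mult ha'] with ξ h1 h2
  rw [h1, h2, norm_smul, norm_smul, ← mul_assoc]
  gcongr
  exact h ξ

theorem InDom.of_le {m m' : X d → ℂ} {a : L2 d F} {c : ℝ} (ha' : InDom m' a) (hm : Measurable m)
    (h : ∀ ξ, ‖m ξ‖ ≤ c * ‖m' ξ‖) : InDom m a := by
  refine MemLp.of_le_mul (c := c) ha' ?_ ?_
  · exact hm.aestronglyMeasurable.smul (Lp.aestronglyMeasurable _)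
  · filter_upwards with ξ
    rw [norm_smul, norm_smul, ← mul_assoc]
    gcongr
    exact h ξ

theorem mult_one (a : L2 d F) : mult (fun _ => 1) a = a :=
  mult_eq_of_ae (by simp)

theorem mult_mult {m m' : X d → ℂ} {a : L2 d F} (ha : InDom m a) (h : ∀ ξ, m' ξ * m ξ = 1) :
    mult m' (mult m a) = a := by
  apply mult_eq_of_ae
  filter_upwards [fourier_mult ha] with ξ h1
  rw [h1, smul_smul, h, one_smul]

/-- The Bessel weight of order one. -/
def bessel (s : ℝ) (ξ : X d) : ℂ := (((1 + ‖ξ‖ ^ 2) ^ (s / 2) : ℝ) : ℂ)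

theorem toTemperedDistribution_injective {a b : L2 d F}
    (h : (a : 𝓢'(X d, F)) = (b : 𝓢'(X d, F))) : a = b := by
  have := LinearMap.ker_eq_bot.1
    (Lp.ker_toTemperedDistributionCLM_eq_bot (F := F) (μ := (volume : Measure (X d))) (p := 2))
  exact this h

/-- The Sobolev condition concerns tempered distributions. The inverse weight `bessel (-1)` is
bounded, so it acts both on `L²` and on distributions; multiplying by it and using that `L²` embeds
injectively turns the condition into one on functions. -/
theorem isH1_iff (ψ : L2 d F) : IsH1 ψ ↔ InDom (bessel 1) ψ := by
  have hg1 : (bessel 1 : X d → ℂ).HasTemperateGrowth := by unfold bessel; fun_prop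
  have hg2 : (bessel (-1) : X d → ℂ).HasTemperateGrowth := by unfold bessel; fun_prop
  have hmul : ∀ ξ : X d, bessel 1 ξ * bessel (-1) ξ = 1 := by
    intro ξ
    unfold bessel
    rw [← Complex.ofReal_mul, ← Real.rpow_add (by positivity)]
    norm_num
  have hb : MemLp (bessel (-1) : X d → ℂ) ⊤ volume := by
    refine memLp_top_of_bound hg2.1.continuous.aestronglyMeasurable 1 (ae_of_all _ fun ξ => ?_)
    unfold bessel
    rw [Complex.norm_real, Real.norm_eq_abs, abs_of_nonneg (by positivity)]
    exact Real.rpow_le_one_of_one_le_of_nonpos (by simp) (by norm_num)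
  have key : ∀ f' : L2 d F, ((hb.toLp _ • f' : L2 d F) : 𝓢'(X d, F)) =
      TemperedDistribution.smulLeftCLM F (bessel (-1)) (f' : 𝓢'(X d, F)) := fun f' =>
    Lp.toTemperedDistribution_smul_eq hg2 hb f'
  have key2 : ∀ f' : L2 d F, (hb.toLp _ • f' : L2 d F) =ᵐ[volume]
      fun ξ => bessel (-1) ξ • f' ξ := by
    intro f'
    filter_upwards [Lp.coeFn_lpSMul (r := 2) (hb.toLp _) f', hb.coeFn_toLp] with ξ h1 h2
    rw [h1, Pi.smul_apply', h2]
  have hone : (bessel 1 * bessel (-1) : X d → ℂ) = fun _ => 1 := funext hmul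
  have hone' : (bessel (-1) * bessel 1 : X d → ℂ) = fun _ => 1 :=
    funext fun ξ => (mul_comm _ _).trans (hmul ξ)
  unfold IsH1
  rw [TemperedDistribution.memSobolev_iff_exists_smulLeftCLM_fourier,
    Lp.fourier_toTemperedDistribution_eq]
  constructor
  · rintro ⟨f', hf'⟩
    have hf2 : TemperedDistribution.smulLeftCLM F (bessel 1 : X d → ℂ)
        ((𝓕 ψ : L2 d F) : 𝓢'(X d, F)) = (f' : 𝓢'(X d, F)) := hf'
    have h3 := key f'
    rw [← hf2, TemperedDistribution.smulLeftCLM_smulLeftCLM_apply hg1 hg2, hone,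
      TemperedDistribution.smulLeftCLM_const, one_smul] at h3
    have h4 := toTemperedDistribution_injective h3
    refine (Lp.memLp f').ae_eq ?_
    filter_upwards [key2 f'] with ξ h5
    rw [← h4, h5, smul_smul, hmul, one_smul]
  · intro h
    have h' : MemLp (fun ξ => bessel 1 ξ • (𝓕 ψ : L2 d F) ξ) 2 volume := h
    refine ⟨h'.toLp _, ?_⟩
    have h4 : (hb.toLp _ • h'.toLp _ : L2 d F) = 𝓕 ψ := by
      apply Lp.ext
      filter_upwards [key2 (h'.toLp _), h'.coeFn_toLp] with ξ h5 h6
      rw [h5, h6, smul_smul, mul_comm, hmul, one_smul]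
    change TemperedDistribution.smulLeftCLM F (bessel 1 : X d → ℂ) _ = _
    generalize h'.toLp _ = f' at h4 ⊢
    rw [← h4, key, TemperedDistribution.smulLeftCLM_smulLeftCLM_apply hg2 hg1, hone',
      TemperedDistribution.smulLeftCLM_const, one_smul]

theorem IsH1.sub {a b : L2 d F} (ha : IsH1 a) (hb : IsH1 b) : IsH1 (a - b) := by
  rw [isH1_iff] at *
  exact ha.sub hb

end Multiplier

/-! ### Powers of `-Δ + lam`, derivatives, and interpolation. -/

section Laplace

variable {d : ℕ} {F : Type} [NormedAddCommGroup F] [InnerProductSpace ℂ F] [CompleteSpace F]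

/-- The symbol of `(-Δ + lam)^s`. -/
def lapSym (lam s : ℝ) (ξ : X d) : ℂ := (((4 * Real.pi ^ 2 * ‖ξ‖ ^ 2 + lam) ^ s : ℝ) : ℂ)

/-- The symbol of `∂ⱼ`. -/
def derivSym (j : Fin d) (ξ : X d) : ℂ := 2 * Real.pi * Complex.I * (ξ j : ℂ)

theorem lapPow_eq (lam s : ℝ) (ψ : L2 d F) : lapPow lam s ψ = mult (lapSym lam s) ψ := rfl

theorem partialD_eq (j : Fin d) (ψ : L2 d F) : partialD j ψ = mult (derivSym j) ψ := rfl

theorem measurable_lapSym (lam s : ℝ) : Measurable (lapSym lam s : X d → ℂ) := by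
  unfold lapSym; fun_prop

theorem measurable_derivSym (j : Fin d) : Measurable (derivSym j : X d → ℂ) := by
  unfold derivSym; fun_prop

theorem norm_lapSym {lam : ℝ} (hlam : 0 < lam) (s : ℝ) (ξ : X d) :
    ‖lapSym lam s ξ‖ = (4 * Real.pi ^ 2 * ‖ξ‖ ^ 2 + lam) ^ s := by
  unfold lapSym
  rw [Complex.norm_real, Real.norm_eq_abs, abs_of_nonneg (by positivity)]

theorem norm_derivSym_sq (j : Fin d) (ξ : X d) :
    ‖derivSym j ξ‖ ^ 2 = 4 * Real.pi ^ 2 * ξ j ^ 2 := by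
  unfold derivSym
  simp only [norm_mul, Complex.norm_I, Complex.norm_real, Real.norm_eq_abs, Complex.norm_ofNat,
    mul_pow, sq_abs]
  ring

theorem norm_lapSym_half_sq {lam : ℝ} (hlam : 0 < lam) (ξ : X d) :
    ‖lapSym lam (1 / 2) ξ‖ ^ 2 = 4 * Real.pi ^ 2 * ‖ξ‖ ^ 2 + lam := by
  rw [norm_lapSym hlam, ← Real.sqrt_eq_rpow, Real.sq_sqrt (by positivity)]

theorem norm_lapSym_le {lam : ℝ} (hlam : 0 < lam) {s : ℝ} (hs : s ≤ 1 / 2) (ξ : X d) :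
    ‖lapSym lam s ξ‖ ≤ lam ^ (s - 1 / 2) * ‖lapSym lam (1 / 2) ξ‖ := by
  rw [norm_lapSym hlam, norm_lapSym hlam]
  have h : (4 * Real.pi ^ 2 * ‖ξ‖ ^ 2 + lam) ^ s = (4 * Real.pi ^ 2 * ‖ξ‖ ^ 2 + lam) ^ (s - 1 / 2) *
      (4 * Real.pi ^ 2 * ‖ξ‖ ^ 2 + lam) ^ (1 / 2 : ℝ) := by
    rw [← Real.rpow_add (by positivity)]; norm_num
  rw [h]
  gcongr ?_ * _
  apply Real.rpow_le_rpow_of_nonpos hlam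
  · have : 0 ≤ 4 * Real.pi ^ 2 * ‖ξ‖ ^ 2 := by positivity
    linarith
  · linarith

theorem norm_derivSym_le {lam : ℝ} (hlam : 0 < lam) (j : Fin d) (ξ : X d) :
    ‖derivSym j ξ‖ ≤ 1 * ‖lapSym lam (1 / 2) ξ‖ := by
  rw [one_mul]
  refine le_of_sq_le_sq ?_ (norm_nonneg _)
  rw [norm_derivSym_sq, norm_lapSym_half_sq hlam]
  have h : ξ j ^ 2 ≤ ‖ξ‖ ^ 2 := by
    rw [EuclideanSpace.real_norm_sq_eq]
    exact Finset.single_le_sum (f := fun i => ξ i ^ 2) (fun i _ => sq_nonneg _) (Finset.mem_univ j)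
  have : 4 * Real.pi ^ 2 * ξ j ^ 2 ≤ 4 * Real.pi ^ 2 * ‖ξ‖ ^ 2 := by gcongr
  linarith

theorem norm_bessel_sq (ξ : X d) : ‖bessel 1 ξ‖ ^ 2 = 1 + ‖ξ‖ ^ 2 := by
  unfold bessel
  rw [Complex.norm_real, Real.norm_eq_abs, abs_of_nonneg (by positivity), ← Real.sqrt_eq_rpow,
    Real.sq_sqrt (by positivity)]

/-- The symbols `1 + ‖ξ‖²` and `4π²‖ξ‖² + lam` dominate each other up to constants. From here on the
`H¹` norm is `‖lapPow lam (1 / 2) ·‖`. -/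
theorem isH1_iff_half {lam : ℝ} (hlam : 0 < lam) (ψ : L2 d F) :
    IsH1 ψ ↔ InDom (lapSym lam (1 / 2)) ψ := by
  rw [isH1_iff]
  have hp := Real.pi_gt_three
  constructor
  · intro h
    refine h.of_le (c := Real.sqrt (4 * Real.pi ^ 2 + lam)) (measurable_lapSym _ _) fun ξ => ?_
    refine le_of_sq_le_sq ?_ (by positivity)
    rw [mul_pow, Real.sq_sqrt (by positivity), norm_lapSym_half_sq hlam, norm_bessel_sq]
    nlinarith [sq_nonneg ‖ξ‖, mul_nonneg hlam.le (sq_nonneg ‖ξ‖), sq_nonneg Real.pi]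
  · intro h
    refine h.of_le (c := Real.sqrt (1 + 1 / lam)) (by unfold bessel; fun_prop) fun ξ => ?_
    refine le_of_sq_le_sq ?_ (by positivity)
    rw [mul_pow, Real.sq_sqrt (by positivity), norm_lapSym_half_sq hlam, norm_bessel_sq]
    have h1 : 1 / lam * lam = 1 := by field_simp
    have h2 : ‖ξ‖ ^ 2 ≤ 4 * Real.pi ^ 2 * ‖ξ‖ ^ 2 :=
      le_mul_of_one_le_left (sq_nonneg _) (by nlinarith)
    have h3 : 0 ≤ 1 / lam * (4 * Real.pi ^ 2 * ‖ξ‖ ^ 2) := by positivity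
    nlinarith

theorem IsH1.inDom_lapSym {ψ : L2 d F} (h : IsH1 ψ) {lam : ℝ} (hlam : 0 < lam) {s : ℝ}
    (hs : s ≤ 1 / 2) : InDom (lapSym lam s) ψ :=
  ((isH1_iff_half hlam ψ).1 h).of_le (measurable_lapSym _ _) (norm_lapSym_le hlam hs)

theorem IsH1.inDom_derivSym {ψ : L2 d F} (h : IsH1 ψ) (j : Fin d) : InDom (derivSym j) ψ :=
  ((isH1_iff_half one_pos ψ).1 h).of_le (measurable_derivSym _) (norm_derivSym_le one_pos j)

theorem lapPow_sub {lam : ℝ} (hlam : 0 < lam) {s : ℝ} (hs : s ≤ 1 / 2) {a b : L2 d F}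
    (ha : IsH1 a) (hb : IsH1 b) : lapPow lam s (a - b) = lapPow lam s a - lapPow lam s b :=
  mult_sub (ha.inDom_lapSym hlam hs) (hb.inDom_lapSym hlam hs)

theorem partialD_sub (j : Fin d) {a b : L2 d F} (ha : IsH1 a) (hb : IsH1 b) :
    partialD j (a - b) = partialD j a - partialD j b :=
  mult_sub (ha.inDom_derivSym j) (hb.inDom_derivSym j)

theorem norm_lapPow_le {lam : ℝ} (hlam : 0 < lam) {s : ℝ} (hs : s ≤ 1 / 2) {a : L2 d F}
    (ha : IsH1 a) : ‖lapPow lam s a‖ ≤ lam ^ (s - 1 / 2) * ‖lapPow lam (1 / 2) a‖ :=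
  norm_mult_le (ha.inDom_lapSym hlam hs) (ha.inDom_lapSym hlam le_rfl) (norm_lapSym_le hlam hs)

theorem norm_partialD_le {lam : ℝ} (hlam : 0 < lam) (j : Fin d) {a : L2 d F}
    (ha : IsH1 a) : ‖partialD j a‖ ≤ ‖lapPow lam (1 / 2) a‖ := by
  have := norm_mult_le (ha.inDom_derivSym j) (ha.inDom_lapSym hlam le_rfl) (norm_derivSym_le hlam j)
  rwa [one_mul] at this

theorem norm_le_lapPow {lam : ℝ} (hlam : 0 < lam) {a : L2 d F} (ha : IsH1 a) :
    ‖a‖ ≤ lam ^ (-(1 / 2) : ℝ) * ‖lapPow lam (1 / 2) a‖ := by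
  have h := norm_lapPow_le hlam (s := 0) (by norm_num) ha
  have h0 : lapPow lam 0 a = a := by
    have : (lapSym lam 0 : X d → ℂ) = fun _ => 1 := by funext ξ; simp [lapSym]
    rw [lapPow_eq, this, mult_one]
  rw [h0] at h
  simpa using h

theorem norm_lapPow_half_sq {lam : ℝ} (hlam : 0 < lam) {a : L2 d F} (ha : IsH1 a) :
    ‖lapPow lam (1 / 2) a‖ ^ 2 = ∑ j, ‖partialD j a‖ ^ 2 + lam * ‖a‖ ^ 2 := by
  have h1 : ‖a‖ ^ 2 = ∫ ξ, ‖(𝓕 a : L2 d F) ξ‖ ^ 2 := by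
    rw [← Lp.norm_fourier_eq a, norm_sq_eq_integral]
  have h2 : ∀ j, ‖partialD j a‖ ^ 2 = ∫ ξ, ‖derivSym j ξ‖ ^ 2 * ‖(𝓕 a : L2 d F) ξ‖ ^ 2 := fun j =>
    norm_mult_sq (ha.inDom_derivSym j)
  simp_rw [h2]
  rw [lapPow_eq, norm_mult_sq (ha.inDom_lapSym hlam le_rfl), h1, ← integral_const_mul,
    ← integral_finsetSum _ fun j _ => (ha.inDom_derivSym j).integrable, ← integral_add]
  · refine integral_congr_ae (ae_of_all _ fun ξ => ?_)
    simp only [norm_lapSym_half_sq hlam, norm_derivSym_sq, EuclideanSpace.real_norm_sq_eq]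
    rw [← Finset.sum_mul, ← Finset.mul_sum, add_mul]
  · exact integrable_finsetSum _ fun j _ => (ha.inDom_derivSym j).integrable
  · exact (integrable_norm_sq _).const_mul _

theorem rpow_le_mul_add {p : ℝ} (hp0 : 0 < p) (hp : p < 1) {ε : ℝ} (hε : 0 < ε) :
    ∃ C : ℝ, 0 ≤ C ∧ ∀ t : ℝ, 0 < t → t ^ p ≤ ε * t + C := by
  -- `T` solves `T ^ (p - 1) = ε`: beyond it the linear term wins, below it `t ^ p ≤ T ^ p`.
  set T : ℝ := ε ^ (1 / (p - 1)) with hT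
  have hT0 : 0 < T := by positivity
  refine ⟨T ^ p, by positivity, fun t ht => ?_⟩
  rcases le_total t T with h | h
  · have := Real.rpow_le_rpow ht.le h hp0.le
    nlinarith
  · have h1 : t ^ p = t ^ (p - 1) * t := by
      nth_rewrite 3 [← Real.rpow_one t]
      rw [← Real.rpow_add ht]; congr 1; ring
    have h2 : t ^ (p - 1) ≤ T ^ (p - 1) := Real.rpow_le_rpow_of_nonpos hT0 h (by linarith)
    have h3 : T ^ (p - 1) = ε := by
      rw [hT, ← Real.rpow_mul hε.le, one_div, inv_mul_cancel₀ (by linarith), Real.rpow_one]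
    have h4 : 0 ≤ T ^ p := by positivity
    rw [h1]
    nlinarith

/-- The squared symbol is the power `2δ < 1` of `4π²‖ξ‖² + lam`, so `rpow_le_mul_add` applies
pointwise in `ξ`. This is where `δ < 1/2` gives both small relative bounds and compactness. -/
theorem lapPow_interpolation {lam : ℝ} (hlam : 0 < lam) {δ : ℝ} (hδ : 0 < δ) (hδ' : δ < 1 / 2)
    {ε : ℝ} (hε : 0 < ε) : ∃ C : ℝ, 0 ≤ C ∧ ∀ a : L2 d F, IsH1 a →
      ‖lapPow lam δ a‖ ^ 2 ≤ ε * ‖lapPow lam (1 / 2) a‖ ^ 2 + C * ‖a‖ ^ 2 := by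
  obtain ⟨C, hC0, hC⟩ := rpow_le_mul_add (p := 2 * δ) (by linarith) (by linarith) hε
  refine ⟨C, hC0, fun a ha => ?_⟩
  have h1 : ‖a‖ ^ 2 = ∫ ξ, ‖(𝓕 a : L2 d F) ξ‖ ^ 2 := by
    rw [← Lp.norm_fourier_eq a, norm_sq_eq_integral]
  rw [lapPow_eq, lapPow_eq, norm_mult_sq (ha.inDom_lapSym hlam le_rfl),
    norm_mult_sq (ha.inDom_lapSym hlam hδ'.le), h1, ← integral_const_mul, ← integral_const_mul,
    ← integral_add ((ha.inDom_lapSym hlam le_rfl).integrable.const_mul _)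
      ((integrable_norm_sq _).const_mul _)]
  refine integral_mono (ha.inDom_lapSym hlam hδ'.le).integrable
    (((ha.inDom_lapSym hlam le_rfl).integrable.const_mul _).add
      ((integrable_norm_sq _).const_mul _)) fun ξ => ?_
  simp only
  rw [norm_lapSym_half_sq hlam, norm_lapSym hlam, ← Real.rpow_natCast, ← Real.rpow_mul (by positivity),
    ← mul_assoc, ← add_mul]
  gcongr
  have := hC (4 * Real.pi ^ 2 * ‖ξ‖ ^ 2 + lam) (by positivity)
  rw [mul_comm δ]
  exact_mod_cast this

end Laplace

/-! ### Constant matrices commute with Fourier multipliers. -/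

section CompLp

variable {d : ℕ} {F G : Type} [NormedAddCommGroup F] [InnerProductSpace ℂ F] [CompleteSpace F]
  [NormedAddCommGroup G] [InnerProductSpace ℂ G] [CompleteSpace G]

theorem fourier_postcomp (T : F →L[ℂ] G) (f : 𝓢(X d, F)) :
    𝓕 (SchwartzMap.postcompCLM T f) = SchwartzMap.postcompCLM T (𝓕 f) := by
  ext ξ
  rw [SchwartzMap.postcompCLM_apply, SchwartzMap.fourier_coe, SchwartzMap.fourier_coe,
    Real.fourier_eq, Real.fourier_eq, ← ContinuousLinearMap.integral_comp_comm]
  · refine integral_congr_ae (ae_of_all _ fun x => ?_)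
    simp only [SchwartzMap.postcompCLM_apply]
    exact (T.map_smul_of_tower _ _).symm
  · exact (Real.fourierIntegral_convergent_iff ξ).2 f.integrable

omit [CompleteSpace F] [CompleteSpace G] in
theorem compLp_toLp (T : F →L[ℂ] G) (f : 𝓢(X d, F)) :
    T.compLp (f.toLp 2 : L2 d F) = (SchwartzMap.postcompCLM T f).toLp 2 := by
  apply Lp.ext
  filter_upwards [T.coeFn_compLp (f.toLp 2 : L2 d F), f.coeFn_toLp 2 volume,
    (SchwartzMap.postcompCLM T f).coeFn_toLp 2 volume] with x h1 h2 h3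
  rw [h1, h2, h3, SchwartzMap.postcompCLM_apply]

/-- For Schwartz functions `T` passes through the Fourier integral; density and continuity do the
rest. It serves the Pauli matrices and the passage to scalar components. -/
theorem fourier_compLp (T : F →L[ℂ] G) (ψ : L2 d F) :
    𝓕 (T.compLp ψ : L2 d G) = T.compLp (𝓕 ψ : L2 d F) := by
  refine DenseRange.induction_on (p := fun ψ : L2 d F => 𝓕 (T.compLp ψ : L2 d G) =
    T.compLp (𝓕 ψ : L2 d F))
    (SchwartzMap.denseRange_toLpCLM (F := F) (p := 2) ENNReal.ofNat_ne_top) ψ ?_ ?_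
  · refine isClosed_eq ?_ ?_
    · exact (Lp.fourierTransformₗᵢ (X d) G).continuous.comp (T.compLpL 2 volume).continuous
    · exact (T.compLpL 2 volume).continuous.comp (Lp.fourierTransformₗᵢ (X d) F).continuous
  · intro f
    rw [SchwartzMap.toLpCLM_apply, compLp_toLp, SchwartzMap.toLp_fourier_eq,
      SchwartzMap.toLp_fourier_eq, fourier_postcomp, compLp_toLp]

theorem InDom.compLp {m : X d → ℂ} {ψ : L2 d F} (h : InDom m ψ) (T : F →L[ℂ] G) :
    InDom m (T.compLp ψ) := by
  refine (T.comp_memLp' h).ae_eq ?_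
  rw [fourier_compLp]
  filter_upwards [T.coeFn_compLp (𝓕 ψ : L2 d F)] with ξ h1
  rw [h1, Function.comp_apply, map_smul]

theorem mult_compLp {m : X d → ℂ} {ψ : L2 d F} (h : InDom m ψ) (T : F →L[ℂ] G) :
    mult m (T.compLp ψ) = T.compLp (mult m ψ) := by
  apply mult_eq_of_ae
  rw [fourier_compLp, fourier_compLp]
  filter_upwards [T.coeFn_compLp (𝓕 ψ : L2 d F), T.coeFn_compLp (𝓕 (mult m ψ) : L2 d F),
    fourier_mult h] with ξ h1 h2 h3
  rw [h1, h2, h3, map_smul]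

theorem IsH1.compLp {ψ : L2 d F} (h : IsH1 ψ) (T : F →L[ℂ] G) : IsH1 (T.compLp ψ) := by
  rw [isH1_iff] at *
  exact h.compLp T

end CompLp

/-! ### Test functions, their derivatives, and Schwartz approximation in `H¹`. -/

section Test

variable {d : ℕ} {F : Type} [NormedAddCommGroup F] [InnerProductSpace ℂ F]

/-- `ψ` is represented by the smooth compactly supported function `g`. -/
structure Represents (g : X d → F) (ψ : L2 d F) : Prop where
  smooth : ContDiff ℝ (⊤ : ℕ∞) g
  compact : HasCompactSupport g
  ae_eq : (ψ : X d → F) =ᵐ[volume] g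

theorem isTest_iff (ψ : L2 d F) : IsTest ψ ↔ ∃ g, Represents g ψ :=
  ⟨fun ⟨g, h1, h2, h3⟩ => ⟨g, h1, h2, h3⟩, fun ⟨g, h⟩ => ⟨g, h.1, h.2, h.3⟩⟩

theorem Represents.isTest {g : X d → F} {ψ : L2 d F} (h : Represents g ψ) : IsTest ψ :=
  ⟨g, h.1, h.2, h.3⟩

theorem exists_represents {g : X d → F} (hg : ContDiff ℝ (⊤ : ℕ∞) g) (hc : HasCompactSupport g) :
    ∃ ψ : L2 d F, Represents g ψ :=
  ⟨(hc.toSchwartzMap hg).toLp 2, hg, hc, SchwartzMap.coeFn_toLp _ 2 volume⟩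

theorem Represents.sub {g h : X d → F} {φ ψ : L2 d F} (hφ : Represents g φ)
    (hψ : Represents h ψ) : Represents (g - h) (φ - ψ) where
  smooth := hφ.smooth.sub hψ.smooth
  compact := hφ.compact.sub hψ.compact
  ae_eq := (Lp.coeFn_sub φ ψ).trans (hφ.ae_eq.sub hψ.ae_eq)

theorem norm_le_add_of_ae_le {E₁ E₂ E₃ : Type} [NormedAddCommGroup E₁] [NormedAddCommGroup E₂]
    [NormedAddCommGroup E₃] {b : Lp (α := X d) E₁ 2 volume} {f : Lp (α := X d) E₂ 2 volume}
    {g : Lp (α := X d) E₃ 2 volume} {c c' : ℝ} (hc : 0 ≤ c) (hc' : 0 ≤ c')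
    (h : ∀ᵐ x, ‖b x‖ ≤ c * ‖f x‖ + c' * ‖g x‖) : ‖b‖ ≤ c * ‖f‖ + c' * ‖g‖ := by
  have hf := (Lp.memLp f).norm
  have hg := (Lp.memLp g).norm
  have h1 : ‖b‖ ≤ ‖c • hf.toLp _ + c' • hg.toLp _‖ := by
    apply Lp.norm_le_norm_of_ae_le
    filter_upwards [h, hf.coeFn_toLp, hg.coeFn_toLp, Lp.coeFn_add (c • hf.toLp _) (c' • hg.toLp _),
      Lp.coeFn_smul c (hf.toLp _), Lp.coeFn_smul c' (hg.toLp _)] with x h1 h2 h3 h4 h5 h6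
    rw [h4, Pi.add_apply, h5, h6, Pi.smul_apply, Pi.smul_apply, h2, h3, smul_eq_mul, smul_eq_mul]
    exact h1.trans (le_abs_self _)
  have h2 : ‖hf.toLp _‖ = ‖f‖ := by rw [Lp.norm_toLp, eLpNorm_norm, Lp.norm_def]
  have h3 : ‖hg.toLp _‖ = ‖g‖ := by rw [Lp.norm_toLp, eLpNorm_norm, Lp.norm_def]
  calc ‖b‖ ≤ _ := h1
    _ ≤ ‖c • hf.toLp _‖ + ‖c' • hg.toLp _‖ := norm_add_le _ _
    _ = _ := by
      rw [norm_smul, norm_smul, h2, h3, Real.norm_of_nonneg hc, Real.norm_of_nonneg hc']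

variable [CompleteSpace F]

theorem isH1_toLp (u : 𝓢(X d, F)) : IsH1 (u.toLp 2 : L2 d F) := by
  have := u.memSobolev (s := 1) (p := 2)
  rw [← Lp.toTemperedDistribution_toLp_eq (p := 2)] at this
  exact this

open LineDeriv in
theorem partialD_toLp (j : Fin d) (u : 𝓢(X d, F)) :
    partialD j (u.toLp 2 : L2 d F) = (∂_{EuclideanSpace.single j (1 : ℝ)} u).toLp 2 := by
  rw [partialD_eq]
  apply mult_eq_of_ae
  rw [SchwartzMap.toLp_fourier_eq, SchwartzMap.toLp_fourier_eq, SchwartzMap.fourier_lineDerivOp_eq]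
  have ht : (fun x : X d => inner ℝ x (EuclideanSpace.single j (1 : ℝ))).HasTemperateGrowth := by
    fun_prop
  filter_upwards [SchwartzMap.coeFn_toLp (𝓕 u) 2 volume, SchwartzMap.coeFn_toLp
    ((2 * Real.pi * Complex.I) • SchwartzMap.smulLeftCLM F
      (fun x : X d => inner ℝ x (EuclideanSpace.single j (1 : ℝ))) (𝓕 u)) 2 volume] with ξ h1 h2
  rw [h1, h2, _root_.smul_apply, SchwartzMap.smulLeftCLM_apply_apply ht,
    EuclideanSpace.inner_single_right]
  simp only [derivSym, conj_trivial, one_mul]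
  rw [mul_smul _ _ (𝓕 u ξ)]
  congr 1

omit [CompleteSpace F] in
theorem Represents.eq_toLp {g : X d → F} {ψ : L2 d F} (h : Represents g ψ) :
    ψ = (h.compact.toSchwartzMap h.smooth).toLp 2 :=
  Lp.ext (h.ae_eq.trans
    (SchwartzMap.coeFn_toLp (h.compact.toSchwartzMap h.smooth) 2 volume).symm)

theorem Represents.isH1 {g : X d → F} {ψ : L2 d F} (h : Represents g ψ) : IsH1 ψ := by
  rw [h.eq_toLp]; exact isH1_toLp _

theorem Represents.partialD {g : X d → F} {ψ : L2 d F} (h : Represents g ψ) (j : Fin d) :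
    (partialD j ψ : X d → F) =ᵐ[volume]
      fun x => fderiv ℝ g x (EuclideanSpace.single j 1) := by
  rw [h.eq_toLp, partialD_toLp]
  filter_upwards [SchwartzMap.coeFn_toLp (LineDeriv.lineDerivOp
    (EuclideanSpace.single j (1 : ℝ)) (h.compact.toSchwartzMap h.smooth)) 2 volume] with x hx
  rw [hx, SchwartzMap.lineDerivOp_apply_eq_fderiv]
  rfl

theorem norm_lapPow_half_le {lam : ℝ} (hlam : 0 < lam) {a : L2 d F} (ha : IsH1 a) :
    ‖lapPow lam (1 / 2) a‖ ≤ ∑ j, ‖partialD j a‖ + Real.sqrt lam * ‖a‖ := by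
  refine le_of_sq_le_sq ?_ (by positivity)
  rw [norm_lapPow_half_sq hlam ha]
  have h1 : ∑ j, ‖partialD j a‖ ^ 2 ≤ (∑ j, ‖partialD j a‖) ^ 2 :=
    Finset.sum_sq_le_sq_sum_of_nonneg fun j _ => norm_nonneg _
  have h2 : (Real.sqrt lam * ‖a‖) ^ 2 = lam * ‖a‖ ^ 2 := by rw [mul_pow, Real.sq_sqrt hlam.le]
  have h3 : 0 ≤ (∑ j, ‖partialD j a‖) * (Real.sqrt lam * ‖a‖) := by positivity
  nlinarith

theorem norm_sub_fourierInv (a b : L2 d F) : ‖a - 𝓕⁻ b‖ = ‖𝓕 a - b‖ := by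
  have h1 : 𝓕 a = Lp.fourierTransformₗᵢ (X d) F a := rfl
  have h2 : 𝓕⁻ b = (Lp.fourierTransformₗᵢ (X d) F).symm b := rfl
  rw [h1, h2, ← (Lp.fourierTransformₗᵢ (X d) F).norm_map, map_sub,
    LinearIsometryEquiv.apply_symm_apply]

/-- Schwartz functions are dense in `L²`, in particular near the weighted Fourier transform of `ψ`;
dividing by the weight and transforming back keeps them Schwartz. -/
theorem exists_schwartz_approx {lam : ℝ} (hlam : 0 < lam) {ψ : L2 d F} (hψ : IsH1 ψ) {ε : ℝ}
    (hε : 0 < ε) : ∃ u : 𝓢(X d, F), ‖lapPow lam (1 / 2) (ψ - (u.toLp 2 : L2 d F))‖ < ε := by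
  have hd : InDom (bessel 1) ψ := (isH1_iff ψ).1 hψ
  set c : ℝ := Real.sqrt (4 * Real.pi ^ 2 + lam) with hc
  have hc0 : 0 < c := Real.sqrt_pos.2 (by positivity)
  have hle : ∀ ξ : X d, ‖lapSym lam (1 / 2) ξ‖ ≤ c * ‖bessel 1 ξ‖ := fun ξ => by
    refine le_of_sq_le_sq ?_ (by positivity)
    rw [mul_pow, hc, Real.sq_sqrt (by positivity), norm_lapSym_half_sq hlam, norm_bessel_sq]
    nlinarith [sq_nonneg ‖ξ‖, mul_nonneg hlam.le (sq_nonneg ‖ξ‖), sq_nonneg Real.pi]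
  obtain ⟨s, hs⟩ := (SchwartzMap.denseRange_toLpCLM (F := F) (p := 2)
    (μ := (volume : Measure (X d))) ENNReal.ofNat_ne_top).exists_dist_lt
    (𝓕 (mult (bessel 1) ψ) : L2 d F) (div_pos hε hc0)
  rw [SchwartzMap.toLpCLM_apply, dist_eq_norm] at hs
  have hg2 : (bessel (-1) : X d → ℂ).HasTemperateGrowth := by unfold bessel; fun_prop
  have hmul : ∀ ξ : X d, bessel 1 ξ * bessel (-1) ξ = 1 := by
    intro ξ
    unfold bessel
    rw [← Complex.ofReal_mul, ← Real.rpow_add (by positivity)]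
    norm_num
  set u : 𝓢(X d, F) := 𝓕⁻ (SchwartzMap.smulLeftCLM F (bessel (-1)) s) with hu
  have hu1 : IsH1 (u.toLp 2 : L2 d F) := isH1_toLp u
  have hu2 : mult (bessel 1) (u.toLp 2 : L2 d F) = 𝓕⁻ (s.toLp 2 : L2 d F) := by
    apply mult_eq_of_ae
    rw [FourierTransform.fourier_fourierInv_eq, SchwartzMap.toLp_fourier_eq, hu,
      FourierTransform.fourier_fourierInv_eq]
    filter_upwards [s.coeFn_toLp 2 volume, SchwartzMap.coeFn_toLp
      (SchwartzMap.smulLeftCLM F (bessel (-1)) s) 2 volume] with ξ h1 h2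
    rw [h1, h2, SchwartzMap.smulLeftCLM_apply_apply hg2, smul_smul, hmul, one_smul]
  refine ⟨u, ?_⟩
  have hdu := (isH1_iff _).1 hu1
  have h3 := norm_mult_le ((hψ.sub hu1).inDom_lapSym hlam le_rfl) (hd.sub hdu) hle
  refine h3.trans_lt ?_
  rw [mult_sub hd hdu, hu2, norm_sub_fourierInv]
  calc _ < c * (ε / c) := by gcongr
    _ = ε := by field_simp

end Test

/-! ### Smooth cutoffs and density of the test functions in `H¹`. -/

section Cutoff

variable {d : ℕ} {F : Type} [NormedAddCommGroup F] [InnerProductSpace ℂ F]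

/-- A smooth cutoff function with values in `[0, 1]`, equal to one on the ball of radius `r`. -/
structure IsCutoff (r : ℝ) (η : X d → ℝ) : Prop where
  smooth : ContDiff ℝ (⊤ : ℕ∞) η
  compact : HasCompactSupport η
  nonneg : ∀ x, 0 ≤ η x
  le_one : ∀ x, η x ≤ 1
  eq_one : ∀ x, ‖x‖ ≤ r → η x = 1

theorem exists_isCutoff (d : ℕ) {r : ℝ} (hr : 0 < r) : ∃ η : X d → ℝ, IsCutoff r η := by
  let f : ContDiffBump (0 : X d) := ⟨r, r + 1, hr, by linarith⟩
  exact ⟨f, f.contDiff, f.hasCompactSupport, fun x => f.nonneg, fun x => f.le_one,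
    fun x hx => f.one_of_mem_closedBall (by simpa [f] using hx)⟩

theorem IsCutoff.exists_fderiv_bound {r : ℝ} {η : X d → ℝ} (h : IsCutoff r η) :
    ∃ K : ℝ, 0 ≤ K ∧ ∀ x, ‖fderiv ℝ η x‖ ≤ K := by
  obtain ⟨K, hK⟩ := (h.compact.fderiv ℝ).exists_bound_of_continuous
    (h.smooth.continuous_fderiv (by simp))
  exact ⟨K, (norm_nonneg _).trans (hK 0), hK⟩

theorem contDiff_smul_cutoff {η : X d → ℝ} (hη : ContDiff ℝ (⊤ : ℕ∞) η) {u : X d → F}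
    (hu : ContDiff ℝ (⊤ : ℕ∞) u) : ContDiff ℝ (⊤ : ℕ∞) (fun x => η x • u x) := hη.smul hu

theorem fderiv_smul_apply {η : X d → ℝ} (hη : ContDiff ℝ (⊤ : ℕ∞) η) {u : X d → F}
    (hu : ContDiff ℝ (⊤ : ℕ∞) u) (x e : X d) :
    fderiv ℝ (fun x => η x • u x) x e = η x • fderiv ℝ u x e + (fderiv ℝ η x e) • u x := by
  rw [fderiv_fun_smul (hη.differentiable (by simp) x) (hu.differentiable (by simp) x)]
  simp

theorem fderiv_scale {η : X d → ℝ} (hη : ContDiff ℝ (⊤ : ℕ∞) η) (c : ℝ) (x e : X d) :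
    fderiv ℝ (fun x => η (c • x)) x e = c * fderiv ℝ η (c • x) e := by
  have h := (hη.differentiable (by simp) (c • x)).hasFDerivAt.comp x
    ((hasFDerivAt_id (𝕜 := ℝ) x).const_smul c)
  have h2 : HasFDerivAt (fun x => η (c • x)) _ x := h
  rw [h2.fderiv]
  simp

/-- Where the left side is nonzero, `1 < R⁻¹‖x‖`, and it never exceeds one. The smooth weight `1 +
‖x‖²` replaces `‖x‖` because it maps Schwartz functions to Schwartz functions. -/
theorem one_sub_cutoff_le {η : X d → ℝ} (h : IsCutoff 1 η) {R : ℝ} (hR : 0 < R) (x : X d) :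
    |1 - η (R⁻¹ • x)| ≤ R⁻¹ * (1 + ‖x‖ ^ 2) := by
  rw [abs_of_nonneg (by linarith [h.le_one (R⁻¹ • x)])]
  by_cases hx : ‖R⁻¹ • x‖ ≤ 1
  · rw [h.eq_one _ hx, sub_self]; positivity
  · push Not at hx
    rw [norm_smul, Real.norm_of_nonneg (by positivity)] at hx
    have h1 : R⁻¹ * ‖x‖ ≤ R⁻¹ * (1 + ‖x‖ ^ 2) := by
      gcongr
      nlinarith [sq_nonneg (‖x‖ - 1)]
    linarith [h.nonneg (R⁻¹ • x)]

variable [CompleteSpace F]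

omit [CompleteSpace F] in
theorem norm_sub_cutoff_le {η : X d → ℝ} (hη : IsCutoff 1 η) {R : ℝ} (hR : 0 < R)
    {u : 𝓢(X d, F)} {U W φ : L2 d F} (hU : (U : X d → F) =ᵐ[volume] u)
    (hW : (W : X d → F) =ᵐ[volume] fun x => (1 + ‖x‖ ^ 2 : ℝ) • u x)
    (hφ : (φ : X d → F) =ᵐ[volume] fun x => η (R⁻¹ • x) • u x) : ‖U - φ‖ ≤ R⁻¹ * ‖W‖ := by
  apply norm_le_of_ae_le
  filter_upwards [Lp.coeFn_sub U φ, hU, hW, hφ] with x h1 h2 h3 h4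
  rw [h1, Pi.sub_apply, h2, h3, h4]
  have : u x - η (R⁻¹ • x) • u x = (1 - η (R⁻¹ • x)) • u x := by rw [sub_smul, one_smul]
  rw [this, norm_smul, norm_smul, Real.norm_eq_abs, ← mul_assoc,
    Real.norm_of_nonneg (by positivity : 0 ≤ 1 + ‖x‖ ^ 2)]
  gcongr
  exact one_sub_cutoff_le hη hR x

/-- By Leibniz the error has a tail of the derivative, handled by the weight, and a term with the
gradient of the dilated cutoff, which carries a factor `R⁻¹`. -/
theorem norm_partialD_sub_cutoff_le {η : X d → ℝ} (hη : IsCutoff 1 η) {K : ℝ} (hK0 : 0 ≤ K)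
    (hK : ∀ x, ‖fderiv ℝ η x‖ ≤ K) {R : ℝ} (hR : 0 < R) {j : Fin d}
    {u : 𝓢(X d, F)} {U W φ : L2 d F} (hU1 : IsH1 U) (hU : (U : X d → F) =ᵐ[volume] u)
    (hd : (partialD j U : X d → F) =ᵐ[volume] fun x => fderiv ℝ u x (EuclideanSpace.single j 1))
    (hW : (W : X d → F) =ᵐ[volume]
      fun x => (1 + ‖x‖ ^ 2 : ℝ) • fderiv ℝ u x (EuclideanSpace.single j 1))
    (hφ : Represents (fun x => η (R⁻¹ • x) • u x) φ) :
    ‖partialD j (U - φ)‖ ≤ R⁻¹ * ‖W‖ + R⁻¹ * K * ‖U‖ := by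
  have hRi : 0 ≤ R⁻¹ := by positivity
  have hηR : ContDiff ℝ (⊤ : ℕ∞) (fun x => η (R⁻¹ • x)) :=
    hη.smooth.comp (contDiff_const_smul R⁻¹)
  rw [partialD_sub j hU1 hφ.isH1]
  apply norm_le_add_of_ae_le hRi (by positivity)
  filter_upwards [Lp.coeFn_sub (partialD j U) (partialD j φ), hd, hW, hφ.partialD j, hU]
    with x h1 h2 h3 h4 h5
  rw [h1, Pi.sub_apply, h2, h3, h4, h5, fderiv_smul_apply hηR (u.smooth ⊤),
    fderiv_scale hη.smooth]
  set e := EuclideanSpace.single j (1 : ℝ) with he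
  set g := fderiv ℝ u x e with hg
  have : g - (η (R⁻¹ • x) • g + (R⁻¹ * fderiv ℝ η (R⁻¹ • x) e) • u x) =
      (1 - η (R⁻¹ • x)) • g - (R⁻¹ * fderiv ℝ η (R⁻¹ • x) e) • u x := by
    rw [sub_smul, one_smul]; abel
  rw [this]
  refine (norm_sub_le _ _).trans ?_
  rw [norm_smul, norm_smul, norm_smul, Real.norm_eq_abs, ← mul_assoc,
    Real.norm_of_nonneg (by positivity : 0 ≤ 1 + ‖x‖ ^ 2), norm_mul, Real.norm_of_nonneg hRi]
  have he1 : ‖fderiv ℝ η (R⁻¹ • x) e‖ ≤ K := by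
    refine ((fderiv ℝ η (R⁻¹ • x)).le_opNorm e).trans ?_
    rw [he, PiLp.norm_single, norm_one, mul_one]
    exact hK _
  gcongr
  exact one_sub_cutoff_le hη hR x

theorem exists_cutoff_approx {lam : ℝ} (hlam : 0 < lam) (u : 𝓢(X d, F)) :
    ∃ K : ℝ, ∀ R : ℝ, 0 < R → ∃ φ : L2 d F, IsTest φ ∧
      ‖lapPow lam (1 / 2) ((u.toLp 2 : L2 d F) - φ)‖ ≤ K * R⁻¹ := by
  obtain ⟨η, hη⟩ := exists_isCutoff d one_pos
  obtain ⟨K, hK0, hK⟩ := hη.exists_fderiv_bound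
  have htg : (fun x : X d => (1 + ‖x‖ ^ 2 : ℝ)).HasTemperateGrowth := by fun_prop
  have hweight : ∀ v : 𝓢(X d, F), ∃ W : L2 d F,
      (W : X d → F) =ᵐ[volume] fun x => (1 + ‖x‖ ^ 2 : ℝ) • v x := fun v =>
    ⟨(SchwartzMap.smulLeftCLM F (fun x : X d => (1 + ‖x‖ ^ 2 : ℝ)) v).toLp 2, by
      filter_upwards [(SchwartzMap.smulLeftCLM F
        (fun x : X d => (1 + ‖x‖ ^ 2 : ℝ)) v).coeFn_toLp 2 volume] with x hx
      rw [hx, SchwartzMap.smulLeftCLM_apply_apply htg]⟩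
  have hderiv : ∀ j, (partialD j (u.toLp 2 : L2 d F) : X d → F) =ᵐ[volume]
      fun x => fderiv ℝ u x (EuclideanSpace.single j 1) := fun j => by
    rw [partialD_toLp]
    filter_upwards [SchwartzMap.coeFn_toLp
      (LineDeriv.lineDerivOp (EuclideanSpace.single j (1 : ℝ)) u) 2 volume] with x hx
    rw [hx, SchwartzMap.lineDerivOp_apply_eq_fderiv]
  obtain ⟨W, hW⟩ := hweight u
  choose V hV using fun j : Fin d =>
    hweight (LineDeriv.lineDerivOp (EuclideanSpace.single j (1 : ℝ)) u)
  simp only [SchwartzMap.lineDerivOp_apply_eq_fderiv] at hV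
  have hU : ((u.toLp 2 : L2 d F) : X d → F) =ᵐ[volume] u := u.coeFn_toLp 2 volume
  have hU1 : IsH1 (u.toLp 2 : L2 d F) := isH1_toLp u
  generalize (u.toLp 2 : L2 d F) = U at hderiv hU hU1 ⊢
  refine ⟨∑ j, (‖V j‖ + K * ‖U‖) + Real.sqrt lam * ‖W‖, fun R hR => ?_⟩
  have hηR : ContDiff ℝ (⊤ : ℕ∞) (fun x => η (R⁻¹ • x)) :=
    hη.smooth.comp (contDiff_const_smul R⁻¹)
  have hcs : HasCompactSupport (fun x => η (R⁻¹ • x)) :=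
    hη.compact.comp_homeomorph (Homeomorph.smulOfNeZero R⁻¹ (inv_ne_zero hR.ne'))
  obtain ⟨φ, hφ⟩ := exists_represents (contDiff_smul_cutoff hηR (u.smooth ⊤))
    (hcs.smul_right (f' := u))
  refine ⟨φ, hφ.isTest, ?_⟩
  refine (norm_lapPow_half_le hlam (hU1.sub hφ.isH1)).trans ?_
  calc _ ≤ ∑ j, (R⁻¹ * ‖V j‖ + R⁻¹ * K * ‖U‖) + Real.sqrt lam * (R⁻¹ * ‖W‖) := by
        gcongr with j _
        · exact norm_partialD_sub_cutoff_le hη hK0 hK hR hU1 hU (hderiv j) (hV j) hφ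
        · exact norm_sub_cutoff_le hη hR hU hW hφ.ae_eq
    _ = _ := by
        rw [add_mul, Finset.sum_mul]
        congr 1
        · exact Finset.sum_congr rfl fun j _ => by ring
        · ring

theorem lapPow_sub_add {lam : ℝ} (hlam : 0 < lam) {a b c : L2 d F} (ha : IsH1 a) (hb : IsH1 b)
    (hc : IsH1 c) : ‖lapPow lam (1 / 2) (a - c)‖ ≤
      ‖lapPow lam (1 / 2) (a - b)‖ + ‖lapPow lam (1 / 2) (b - c)‖ := by
  rw [lapPow_sub hlam le_rfl ha hc, lapPow_sub hlam le_rfl ha hb, lapPow_sub hlam le_rfl hb hc]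
  exact norm_sub_le_norm_sub_add_norm_sub _ _ _

/-- The test functions are dense in `H¹`. -/
theorem exists_test_approx {lam : ℝ} (hlam : 0 < lam) {ψ : L2 d F} (hψ : IsH1 ψ) {ε : ℝ}
    (hε : 0 < ε) : ∃ φ : L2 d F, IsTest φ ∧ ‖lapPow lam (1 / 2) (ψ - φ)‖ < ε := by
  obtain ⟨u, hu⟩ := exists_schwartz_approx hlam hψ (half_pos hε)
  obtain ⟨K, hK⟩ := exists_cutoff_approx hlam u
  -- This radius makes `K * R⁻¹ < ε / 2`; the absolute value is there because `K` comes without a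
  -- sign.
  obtain ⟨φ, hφ, hle⟩ := hK ((2 * |K| + 1) / ε) (by positivity)
  obtain ⟨g, hg⟩ := (isTest_iff φ).1 hφ
  refine ⟨φ, hφ, (lapPow_sub_add hlam hψ (isH1_toLp u) hg.isH1).trans_lt ?_⟩
  have h1 : K * ((2 * |K| + 1) / ε)⁻¹ < ε / 2 := by
    rw [inv_div, ← mul_div_assoc, div_lt_iff₀ (by positivity)]
    nlinarith [le_abs_self K]
  linarith

/-- Multiplication of a test function by a cutoff is bounded in `H¹`. -/
theorem exists_cutoff_mul_bound {lam : ℝ} (hlam : 0 < lam) {r : ℝ} {η : X d → ℝ}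
    (hη : IsCutoff r η) : ∃ K : ℝ, 0 ≤ K ∧ ∀ (g : X d → F) (φ φ' : L2 d F), Represents g φ →
      Represents (fun x => η x • g x) φ' →
      ‖lapPow lam (1 / 2) φ'‖ ≤ K * ‖lapPow lam (1 / 2) φ‖ := by
  obtain ⟨K, hK0, hK⟩ := hη.exists_fderiv_bound
  set c : ℝ := lam ^ (-(1 / 2) : ℝ) with hc
  have hc0 : 0 ≤ c := by positivity
  refine ⟨∑ _j : Fin d, (1 + K * c) + Real.sqrt lam * c, by positivity,
    fun g φ φ' hφ hφ' => ?_⟩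
  have hn := norm_le_lapPow hlam hφ.isH1
  have h0 : ‖φ'‖ ≤ 1 * ‖φ‖ := by
    apply norm_le_of_ae_le
    filter_upwards [hφ.ae_eq, hφ'.ae_eq] with x h1 h2
    rw [h1, h2, norm_smul, Real.norm_of_nonneg (hη.nonneg x)]
    gcongr
    exact hη.le_one x
  have hj : ∀ j, ‖partialD j φ'‖ ≤ 1 * ‖partialD j φ‖ + K * ‖φ‖ := by
    intro j
    apply norm_le_add_of_ae_le zero_le_one hK0
    filter_upwards [hφ.ae_eq, hφ'.partialD j, hφ.partialD j] with x h1 h2 h3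
    rw [h1, h2, h3, fderiv_smul_apply hη.smooth hφ.smooth]
    refine (norm_add_le _ _).trans ?_
    rw [norm_smul, norm_smul, Real.norm_of_nonneg (hη.nonneg x)]
    gcongr
    · exact hη.le_one x
    · refine ((fderiv ℝ η x).le_opNorm _).trans ?_
      rw [PiLp.norm_single, norm_one, mul_one]
      exact hK _
  refine (norm_lapPow_half_le hlam hφ'.isH1).trans ?_
  rw [add_mul, Finset.sum_mul]
  refine add_le_add (Finset.sum_le_sum fun j _ => (hj j).trans ?_) ?_
  · have := norm_partialD_le hlam j hφ.isH1
    have h2 := mul_le_mul_of_nonneg_left hn hK0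
    linarith
  · rw [mul_assoc]
    gcongr
    linarith

end Cutoff

/-! ### Local compactness of `H¹` in `L²` by the Fourier transform. -/

section Compactness

variable {d : ℕ} {F : Type} [NormedAddCommGroup F] [InnerProductSpace ℂ F]

/-- `χ` converges weakly to zero. -/
def WeakNull (χ : ℕ → L2 d F) : Prop :=
  ∀ φ : L2 d F, Tendsto (fun n => inner ℂ φ (χ n)) atTop (𝓝 0)

/-- A plane wave times a cutoff is in `L²`, so each Fourier coefficient of the truncated function is
a bounded functional of `χ`. Weak convergence thus gives pointwise convergence in `ξ`, with a bound
independent of `ξ`. -/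
theorem exists_inner_fourier_eq [CompleteSpace F] {η : X d → ℝ} {r : ℝ} (hη : IsCutoff r η) :
    ∃ B : ℝ, 0 ≤ B ∧ ∀ (ξ : X d) (c : F), ∃ T : L2 d F, ‖T‖ ≤ B * ‖c‖ ∧
      ∀ (g : X d → F) (χ : L2 d F), Represents g χ →
        inner ℂ c (𝓕 (fun x => η x • g x) ξ) = inner ℂ T χ := by
  have hηm : MemLp η 2 volume :=
    hη.smooth.continuous.memLp_of_hasCompactSupport hη.compact
  refine ⟨‖hηm.toLp _‖, norm_nonneg _, fun ξ c => ?_⟩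
  have hcont : Continuous (fun x : X d => Real.fourierChar (inner ℝ x ξ) • (η x • c)) := by
    have := hη.smooth.continuous
    have h2 : Continuous (fun x : X d => Real.fourierChar (inner ℝ x ξ)) := by fun_prop
    fun_prop
  have hcs : HasCompactSupport (fun x : X d => Real.fourierChar (inner ℝ x ξ) • (η x • c)) := by
    refine hη.compact.mono ?_
    intro x hx
    rw [Function.mem_support] at hx ⊢
    intro h
    exact hx (by rw [h, zero_smul, smul_zero])
  have hmem := hcont.memLp_of_hasCompactSupport (p := 2) (μ := volume) hcs
  refine ⟨hmem.toLp _, ?_, fun g χ hg => ?_⟩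
  · rw [mul_comm]
    apply Lp.norm_le_mul_norm_of_ae_le_mul
    filter_upwards [hmem.coeFn_toLp, hηm.coeFn_toLp] with x h1 h2
    rw [h1, h2, Circle.norm_smul, norm_smul, mul_comm]
  have hint : Integrable (fun x => Real.fourierChar (-inner ℝ x ξ) • (η x • g x)) volume := by
    refine (Real.fourierIntegral_convergent_iff ξ).2 ?_
    exact (hη.smooth.continuous.smul hg.smooth.continuous).integrable_of_hasCompactSupport
      hg.compact.smul_left
  rw [Real.fourier_eq, ← integral_inner hint, L2.inner_def]
  refine integral_congr_ae ?_
  filter_upwards [hmem.coeFn_toLp, hg.ae_eq] with x h1 h2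
  rw [h1, h2, Circle.smul_def, Circle.smul_def, inner_smul_right, inner_smul_left,
    inner_smul_right_eq_smul, inner_smul_left_eq_smul, AddChar.map_neg_eq_inv,
    Circle.coe_inv_eq_conj]

variable [FiniteDimensional ℂ F]

theorem tendsto_zero_of_inner {p : ℕ → F}
    (h : ∀ c : F, Tendsto (fun n => inner ℂ c (p n)) atTop (𝓝 0)) :
    Tendsto (fun n => ‖p n‖ ^ 2) atTop (𝓝 0) := by
  simp_rw [← (stdOrthonormalBasis ℂ F).sum_sq_norm_inner_right]
  have := tendsto_finsetSum Finset.univ fun i _ => ((h (stdOrthonormalBasis ℂ F i)).norm.pow 2)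
  simpa using this

variable [CompleteSpace F]

/-- Local compactness of the embedding of `H¹` into `L²`, for test functions. -/
theorem tendsto_norm_cutoff {lam : ℝ} (hlam : 0 < lam) {η : X d → ℝ} {r : ℝ} (hη : IsCutoff r η)
    {χ χ' : ℕ → L2 d F} {g : ℕ → X d → F} (hg : ∀ n, Represents (g n) (χ n))
    (hg' : ∀ n, Represents (fun x => η x • g n x) (χ' n)) (hw : WeakNull χ) {M M' : ℝ}
    (hM : ∀ n, ‖χ n‖ ≤ M) (hM' : ∀ n, ‖lapPow lam (1 / 2) (χ' n)‖ ≤ M') :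
    Tendsto (fun n => ‖χ' n‖) atTop (𝓝 0) := by
  obtain ⟨B, hB0, hB⟩ := exists_inner_fourier_eq (F := F) hη
  set p : ℕ → X d → F := fun n => 𝓕 (fun x => η x • g n x) with hp
  have hae : ∀ n, (𝓕 (χ' n) : L2 d F) =ᵐ[volume] p n := fun n => by
    rw [(hg' n).eq_toLp, SchwartzMap.toLp_fourier_eq]
    exact SchwartzMap.coeFn_toLp (𝓕 ((hg' n).compact.toSchwartzMap (hg' n).smooth)) 2 volume
  have hM0 : 0 ≤ M := (norm_nonneg _).trans (hM 0)
  have hpt : ∀ ξ, Tendsto (fun n => ‖p n ξ‖ ^ 2) atTop (𝓝 0) := fun ξ => by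
    apply tendsto_zero_of_inner
    intro c
    obtain ⟨T, -, hT⟩ := hB ξ c
    simp_rw [hp, fun n => hT (g n) (χ n) (hg n)]
    exact hw T
  -- Duality: the functional is tested with `c = p n ξ` itself.
  have hbd : ∀ n ξ, ‖p n ξ‖ ≤ B * M := fun n ξ => by
    obtain ⟨T, hTn, hT⟩ := hB ξ (p n ξ)
    have h1 : ‖p n ξ‖ ^ 2 = ‖inner ℂ (p n ξ) (p n ξ)‖ := by
      rw [inner_self_eq_norm_sq_to_K]; simp
    have h2 : ‖inner ℂ (p n ξ) (p n ξ)‖ ≤ B * ‖p n ξ‖ * M := by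
      rw [hT (g n) (χ n) (hg n)]
      refine (norm_inner_le_norm _ _).trans ?_
      gcongr
      exact hM n
    by_contra hlt
    push Not at hlt
    have h3 : 0 ≤ B * M := by positivity
    nlinarith
  have hpc : ∀ n, Integrable (fun ξ => ‖p n ξ‖ ^ 2) volume := fun n =>
    (integrable_norm_sq (𝓕 (χ' n) : L2 d F)).congr
      ((hae n).mono fun ξ h => by simp only [h])
  -- Low frequencies vanish by dominated convergence; high frequencies are uniformly small by the
  -- `H¹` bound.
  have hball : ∀ R : ℝ, Tendsto (fun n => ∫ ξ in Metric.ball (0 : X d) R, ‖p n ξ‖ ^ 2)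
      atTop (𝓝 0) := fun R => by
    have := tendsto_integral_of_dominated_convergence
      (μ := volume.restrict (Metric.ball (0 : X d) R)) (F := fun n ξ => ‖p n ξ‖ ^ 2)
      (f := fun _ => (0 : ℝ)) (fun _ => (B * M) ^ 2)
      (fun n => (hpc n).aestronglyMeasurable.restrict)
      (integrableOn_const (measure_ball_lt_top.ne))
      (fun n => ae_of_all _ fun ξ => by
        rw [Real.norm_of_nonneg (by positivity)]
        gcongr
        exact hbd n ξ)
      (ae_of_all _ hpt)
    simpa using this
  have hdom : ∀ n, InDom (lapSym lam (1 / 2)) (χ' n) := fun n =>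
    (hg' n).isH1.inDom_lapSym hlam le_rfl
  have htail : ∀ R : ℝ, 0 < R → ∀ n,
      ∫ ξ in (Metric.ball (0 : X d) R)ᶜ, ‖p n ξ‖ ^ 2 ≤ (R ^ 2)⁻¹ * M' ^ 2 := fun R hR n => by
    have h1 : ‖lapPow lam (1 / 2) (χ' n)‖ ^ 2 = ∫ ξ, ‖lapSym lam (1 / 2) ξ‖ ^ 2 * ‖p n ξ‖ ^ 2 := by
      rw [lapPow_eq, norm_mult_sq (hdom n)]
      exact integral_congr_ae ((hae n).mono fun ξ h => by simp only [h])
    have hi : Integrable (fun ξ => ‖lapSym lam (1 / 2) ξ‖ ^ 2 * ‖p n ξ‖ ^ 2) volume :=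
      (hdom n).integrable.congr ((hae n).mono fun ξ h => by simp only [h])
    calc ∫ ξ in (Metric.ball (0 : X d) R)ᶜ, ‖p n ξ‖ ^ 2
        ≤ ∫ ξ in (Metric.ball (0 : X d) R)ᶜ, (R ^ 2)⁻¹ *
            (‖lapSym lam (1 / 2) ξ‖ ^ 2 * ‖p n ξ‖ ^ 2) := by
          refine setIntegral_mono_on (hpc n).integrableOn (hi.const_mul _).integrableOn
            measurableSet_ball.compl fun ξ hξ => ?_
          have hξ' : R ≤ ‖ξ‖ := by simpa using hξ
          rw [norm_lapSym_half_sq hlam, ← mul_assoc]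
          refine le_mul_of_one_le_left (sq_nonneg _) ?_
          rw [inv_mul_eq_div, one_le_div (by positivity)]
          have h2 : R ^ 2 ≤ ‖ξ‖ ^ 2 := by gcongr
          have h3 : ‖ξ‖ ^ 2 ≤ 4 * Real.pi ^ 2 * ‖ξ‖ ^ 2 :=
            le_mul_of_one_le_left (sq_nonneg _) (by nlinarith [Real.pi_gt_three])
          linarith
      _ ≤ ∫ ξ, (R ^ 2)⁻¹ * (‖lapSym lam (1 / 2) ξ‖ ^ 2 * ‖p n ξ‖ ^ 2) :=
          setIntegral_le_integral (hi.const_mul _) (ae_of_all _ fun ξ => by positivity)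
      _ = (R ^ 2)⁻¹ * ‖lapPow lam (1 / 2) (χ' n)‖ ^ 2 := by rw [integral_const_mul, h1]
      _ ≤ _ := by
          gcongr
          exact hM' n
  have hnorm : ∀ n, ‖χ' n‖ ^ 2 = ∫ ξ, ‖p n ξ‖ ^ 2 := fun n => by
    rw [← Lp.norm_fourier_eq (χ' n), norm_sq_eq_integral]
    exact integral_congr_ae ((hae n).mono fun ξ h => by simp only [h])
  have hsq : Tendsto (fun n => ‖χ' n‖ ^ 2) atTop (𝓝 0) := by
    rw [Metric.tendsto_atTop]
    intro ε hε
    set R : ℝ := Real.sqrt ((2 * M' ^ 2 + 1) / ε) with hRdef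
    have hR : 0 < R := Real.sqrt_pos.2 (by positivity)
    have hR2 : (R ^ 2)⁻¹ * M' ^ 2 < ε / 2 := by
      rw [hRdef, Real.sq_sqrt (by positivity), inv_div, div_mul_eq_mul_div,
        div_lt_iff₀ (by positivity)]
      nlinarith
    obtain ⟨N, hN⟩ := (Metric.tendsto_atTop.1 (hball R)) (ε / 2) (by positivity)
    refine ⟨N, fun n hn => ?_⟩
    have h1 := hN n hn
    rw [dist_zero_right] at h1 ⊢
    rw [Real.norm_of_nonneg (by positivity), hnorm n,
      ← integral_add_compl (measurableSet_ball (x := (0 : X d)) (ε := R)) (hpc n)]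
    have h2 := htail R hR n
    have h3 := (le_abs_self _).trans_lt h1
    linarith
  have := hsq.sqrt
  simpa [Real.sqrt_sq (norm_nonneg _)] using this

/-- The truncated sequence is bounded in `H¹` and null in `L²`, so interpolation makes it null at
every intermediate order. -/
theorem tendsto_lapPow_cutoff {lam : ℝ} (hlam : 0 < lam) {δ : ℝ} (hδ : 0 < δ) (hδ' : δ < 1 / 2)
    {η : X d → ℝ} {r : ℝ} (hη : IsCutoff r η)
    {χ χ' : ℕ → L2 d F} {g : ℕ → X d → F} (hg : ∀ n, Represents (g n) (χ n))
    (hg' : ∀ n, Represents (fun x => η x • g n x) (χ' n)) (hw : WeakNull χ) {M : ℝ}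
    (hM : ∀ n, ‖lapPow lam (1 / 2) (χ n)‖ ≤ M) :
    Tendsto (fun n => ‖lapPow lam δ (χ' n)‖) atTop (𝓝 0) := by
  obtain ⟨K, hK0, hK⟩ := exists_cutoff_mul_bound (F := F) hlam hη
  have hb1 : ∀ n, ‖χ n‖ ≤ lam ^ (-(1 / 2) : ℝ) * M := fun n =>
    (norm_le_lapPow hlam (hg n).isH1).trans (by gcongr; exact hM n)
  have hb2 : ∀ n, ‖lapPow lam (1 / 2) (χ' n)‖ ≤ K * M := fun n =>
    (hK _ _ _ (hg n) (hg' n)).trans (by gcongr; exact hM n)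
  have ht := (tendsto_norm_cutoff hlam hη hg hg' hw hb1 hb2).pow 2
  rw [zero_pow two_ne_zero] at ht
  have hsq : Tendsto (fun n => ‖lapPow lam δ (χ' n)‖ ^ 2) atTop (𝓝 0) := by
    rw [Metric.tendsto_atTop]
    intro ε hε
    obtain ⟨C, hC0, hC⟩ := lapPow_interpolation (d := d) (F := F) hlam hδ hδ'
      (ε := ε / (2 * ((K * M) ^ 2 + 1))) (by positivity)
    obtain ⟨N, hN⟩ := (Metric.tendsto_atTop.1 ht) (ε / (2 * (C + 1))) (by positivity)
    refine ⟨N, fun n hn => ?_⟩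
    have h1 := hN n hn
    rw [dist_zero_right, Real.norm_of_nonneg (by positivity)] at h1 ⊢
    have h2 := hC (χ' n) (hg' n).isH1
    have h3 : ‖lapPow lam (1 / 2) (χ' n)‖ ^ 2 ≤ (K * M) ^ 2 := by gcongr; exact hb2 n
    have h4 : ε / (2 * ((K * M) ^ 2 + 1)) * ‖lapPow lam (1 / 2) (χ' n)‖ ^ 2 ≤ ε / 2 := by
      rw [div_mul_eq_mul_div, div_le_iff₀ (by positivity)]
      nlinarith
    have h5 : C * ‖χ' n‖ ^ 2 < ε / 2 := by
      rw [lt_div_iff₀ (by positivity)] at h1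
      nlinarith [sq_nonneg ‖χ' n‖]
    linarith
  have := hsq.sqrt
  simpa [Real.sqrt_sq (norm_nonneg _)] using this

end Compactness

/-! ### Local forms of order below that of `-Δ`, and their cross terms. -/

section Admissible

variable {d : ℕ} {F : Type} [NormedAddCommGroup F] [InnerProductSpace ℂ F] [CompleteSpace F]

/-- A local form that is relatively bounded of order `1/2 + δ` with respect to `-Δ + lam`. -/
structure AdmissibleForm (lam δ K : ℝ) (v : L2 d F → L2 d F → ℂ) : Prop where
  sub_left : ∀ a b c, IsH1 a → IsH1 b → IsH1 c → v (a - b) c = v a c - v b c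
  sub_right : ∀ a b c, IsH1 a → IsH1 b → IsH1 c → v a (b - c) = v a b - v a c
  bound : ∀ a b, IsH1 a → IsH1 b →
    ‖v a b‖ ≤ K * (‖lapPow lam (1 / 2) a‖ * ‖lapPow lam (1 / 2) b‖)
  bound_left : ∀ a b, IsTest a → IsTest b →
    ‖v a b‖ ≤ K * (‖lapPow lam δ a‖ * ‖lapPow lam (1 / 2) b‖)
  bound_right : ∀ a b, IsTest a → IsTest b →
    ‖v a b‖ ≤ K * (‖lapPow lam (1 / 2) a‖ * ‖lapPow lam δ b‖)
  bound_diag : ∀ a, IsH1 a → ‖v a a‖ ≤ K * (‖lapPow lam δ a‖ * ‖lapPow lam (1 / 2) a‖)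
  eq_zero : ∀ a b g h, Represents g a → Represents h b → Disjoint (tsupport g) (tsupport h) →
    v a b = 0

/-- The two one-sided bounds make the definition symmetric, so the cross term `v ψ χ` is treated as
`v χ ψ`. -/
theorem AdmissibleForm.swap {lam δ K : ℝ} {v : L2 d F → L2 d F → ℂ}
    (h : AdmissibleForm lam δ K v) : AdmissibleForm lam δ K (fun a b => v b a) where
  sub_left a b c ha hb hc := h.sub_right c a b hc ha hb
  sub_right a b c ha hb hc := h.sub_left b c a hb hc ha
  bound a b ha hb := by rw [mul_comm ‖lapPow lam (1 / 2) a‖]; exact h.bound b a hb ha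
  bound_left a b ha hb := by rw [mul_comm ‖lapPow lam δ a‖]; exact h.bound_right b a hb ha
  bound_right a b ha hb := by rw [mul_comm ‖lapPow lam (1 / 2) a‖]; exact h.bound_left b a hb ha
  bound_diag := h.bound_diag
  eq_zero a b g g' ha hb hd := h.eq_zero b a g' g hb ha hd.symm

theorem AdmissibleForm.add {lam δ K K' : ℝ} {v w : L2 d F → L2 d F → ℂ}
    (hv : AdmissibleForm lam δ K v) (hw : AdmissibleForm lam δ K' w) :
    AdmissibleForm lam δ (K + K') (fun a b => v a b + w a b) where
  sub_left a b c ha hb hc := by rw [hv.sub_left a b c ha hb hc, hw.sub_left a b c ha hb hc]; ring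
  sub_right a b c ha hb hc := by
    rw [hv.sub_right a b c ha hb hc, hw.sub_right a b c ha hb hc]; ring
  bound a b ha hb := by
    rw [add_mul]
    exact (norm_add_le _ _).trans (add_le_add (hv.bound a b ha hb) (hw.bound a b ha hb))
  bound_left a b ha hb := by
    rw [add_mul]
    exact (norm_add_le _ _).trans (add_le_add (hv.bound_left a b ha hb) (hw.bound_left a b ha hb))
  bound_right a b ha hb := by
    rw [add_mul]
    exact (norm_add_le _ _).trans (add_le_add (hv.bound_right a b ha hb) (hw.bound_right a b ha hb))
  bound_diag a ha := by
    rw [add_mul]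
    exact (norm_add_le _ _).trans (add_le_add (hv.bound_diag a ha) (hw.bound_diag a ha))
  eq_zero a b g h ha hb hd := by rw [hv.eq_zero a b g h ha hb hd, hw.eq_zero a b g h ha hb hd,
    add_zero]

theorem AdmissibleForm.sum {lam δ K : ℝ} {ι : Type} (s : Finset ι)
    {v : ι → L2 d F → L2 d F → ℂ} (hv : ∀ i, AdmissibleForm lam δ K (v i)) :
    AdmissibleForm lam δ (s.card * K) (fun a b => ∑ i ∈ s, v i a b) := by
  classical
  induction s using Finset.induction_on with
  | empty => constructor <;> intros <;> simp
  | insert i s hi ih =>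
    have := (hv i).add ih
    simp_rw [Finset.sum_insert hi, Finset.card_insert_of_notMem hi]
    convert this using 1
    push_cast
    ring

/-- Young's inequality splits the product in `bound_diag`, and interpolation absorbs the term of
order `δ`. `C` is chosen before `v`, hence is uniform over all forms with constant `K`. -/
theorem AdmissibleForm.exists_diag_bound {lam : ℝ} (hlam : 0 < lam) {δ : ℝ} (hδ : 0 < δ)
    (hδ' : δ < 1 / 2) {K : ℝ} (hK : 0 ≤ K) {ε : ℝ} (hε : 0 < ε) :
    ∃ C : ℝ, 0 ≤ C ∧ ∀ v : L2 d F → L2 d F → ℂ, AdmissibleForm lam δ K v → ∀ a, IsH1 a →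
      ‖v a a‖ ≤ ε * ∑ j, ‖partialD j a‖ ^ 2 + C * ‖a‖ ^ 2 := by
  obtain ⟨C, hC0, hC⟩ := lapPow_interpolation (d := d) (F := F) hlam hδ hδ'
    (ε := (ε / (K + 1)) ^ 2) (by positivity)
  refine ⟨ε * lam + (K + 1) ^ 2 / ε * C, by positivity, fun v hv a ha => ?_⟩
  have h1 := hv.bound_diag a ha
  have h2 := hC a ha
  have h3 := norm_lapPow_half_sq hlam ha
  set x := ‖lapPow lam δ a‖
  set y := ‖lapPow lam (1 / 2) a‖
  set z := ‖a‖
  have hx : 0 ≤ x := norm_nonneg _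
  have hy : 0 ≤ y := norm_nonneg _
  -- The Young parameter `t` matches the interpolation parameter `t ^ 2`, so both halves contribute
  -- `t * y ^ 2 / 2`.
  set t := ε / (K + 1) with ht
  have ht0 : 0 < t := by positivity
  have hxy : x * y ≤ t⁻¹ * x ^ 2 / 2 + t * y ^ 2 / 2 := by
    have h4 : 0 ≤ t⁻¹ * (x - t * y) ^ 2 := by positivity
    have h5 : t⁻¹ * (x - t * y) ^ 2 = t⁻¹ * x ^ 2 + t * y ^ 2 - 2 * (x * y) := by field_simp; ring
    linarith
  have h6 : t⁻¹ * x ^ 2 ≤ t * y ^ 2 + t⁻¹ * C * z ^ 2 := by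
    calc t⁻¹ * x ^ 2 ≤ t⁻¹ * (t ^ 2 * y ^ 2 + C * z ^ 2) := by gcongr
      _ = _ := by field_simp
  have h0 : 0 ≤ t⁻¹ * C * z ^ 2 := by positivity
  have h7 : x * y ≤ t * y ^ 2 + t⁻¹ * C * z ^ 2 := by linarith
  have h8 : K * (x * y) ≤ (K + 1) * (t * y ^ 2 + t⁻¹ * C * z ^ 2) := by
    have : 0 ≤ x * y := by positivity
    nlinarith
  have h9 : (K + 1) * (t * y ^ 2 + t⁻¹ * C * z ^ 2) = ε * y ^ 2 + (K + 1) ^ 2 / ε * C * z ^ 2 := by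
    rw [ht]; field_simp
  rw [h9, h3] at h8
  linarith

variable [FiniteDimensional ℂ F]

/-- Only the part of `χ n` near the support of the fixed `ψ` is seen by a local form. That part is
null in the norm of order `δ`, and `bound_left` needs no more. -/
theorem AdmissibleForm.tendsto_test {lam : ℝ} (hlam : 0 < lam) {δ : ℝ} (hδ : 0 < δ)
    (hδ' : δ < 1 / 2) {K : ℝ} {v : ℕ → L2 d F → L2 d F → ℂ}
    (hv : ∀ n, AdmissibleForm lam δ K (v n)) {χ : ℕ → L2 d F} (hχ : ∀ n, IsTest (χ n))
    {ψ : L2 d F} (hψ : IsTest ψ) (hw : WeakNull χ) {M : ℝ}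
    (hM : ∀ n, ‖lapPow lam (1 / 2) (χ n)‖ ≤ M) :
    Tendsto (fun n => v n (χ n) ψ) atTop (𝓝 0) := by
  simp_rw [isTest_iff] at hχ
  choose g hg using hχ
  obtain ⟨h, hh⟩ := (isTest_iff ψ).1 hψ
  obtain ⟨r, hr⟩ := hh.compact.isCompact.isBounded.subset_closedBall (0 : X d)
  -- The margin of one keeps the closed support of `χ n - χ' n` off that of `ψ`; `r` itself may be
  -- negative.
  obtain ⟨η, hη⟩ := exists_isCutoff d (r := |r| + 1) (by positivity)
  have hex : ∀ n, ∃ χ' : L2 d F, Represents (fun x => η x • g n x) χ' := fun n =>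
    exists_represents (contDiff_smul_cutoff hη.smooth (hg n).smooth)
      ((hg n).compact.smul_left (f := η))
  choose χ' hχ' using hex
  have hzero : ∀ n, v n (χ n - χ' n) ψ = 0 := fun n => by
    refine (hv n).eq_zero _ _ _ _ ((hg n).sub (hχ' n)) hh ?_
    rw [Set.disjoint_left]
    intro x hx hx'
    have h1 : ‖x‖ ≤ r := by simpa using hr hx'
    have hclosed : IsClosed {x : X d | |r| + 1 ≤ ‖x‖} := isClosed_le continuous_const continuous_norm
    have hsub : tsupport (g n - fun x => η x • g n x) ⊆ {x : X d | |r| + 1 ≤ ‖x‖} := by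
      refine closure_minimal (fun y hy => ?_) hclosed
      rw [Set.mem_ofPred_eq]
      by_contra hlt
      push Not at hlt
      rw [Function.mem_support, Pi.sub_apply, hη.eq_one y hlt.le, one_smul, sub_self] at hy
      exact hy rfl
    have h2 := hsub hx
    rw [Set.mem_ofPred_eq] at h2
    linarith [le_abs_self r]
  have heq : ∀ n, v n (χ n) ψ = v n (χ' n) ψ := fun n => by
    have := (hv n).sub_left (χ n) (χ' n) ψ (hg n).isH1 (hχ' n).isH1 hh.isH1
    rw [hzero n] at this
    exact (sub_eq_zero.1 this.symm)
  have ht := tendsto_lapPow_cutoff hlam hδ hδ' hη hg hχ' hw hM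
  refine squeeze_zero_norm (a := fun n => K * (‖lapPow lam δ (χ' n)‖ * ‖lapPow lam (1 / 2) ψ‖))
    (fun n => ?_) ?_
  · rw [heq n]
    exact (hv n).bound_left _ _ (hχ' n).isTest hψ
  · simpa using (ht.mul_const ‖lapPow lam (1 / 2) ψ‖).const_mul K

/-- Admissible forms converge to zero along bounded weakly null sequences of `H¹`. -/
theorem AdmissibleForm.tendsto_left {lam : ℝ} (hlam : 0 < lam) {δ : ℝ} (hδ : 0 < δ)
    (hδ' : δ < 1 / 2) {K : ℝ} (hK : 0 ≤ K) {v : ℕ → L2 d F → L2 d F → ℂ}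
    (hv : ∀ n, AdmissibleForm lam δ K (v n)) {χ : ℕ → L2 d F} (hχ : ∀ n, IsH1 (χ n))
    {ψ : L2 d F} (hψ : IsH1 ψ) (hw : WeakNull χ) {M : ℝ}
    (hM : ∀ n, ‖lapPow lam (1 / 2) (χ n)‖ ≤ M) :
    Tendsto (fun n => v n (χ n) ψ) atTop (𝓝 0) := by
  have hM0 : 0 ≤ M := (norm_nonneg _).trans (hM 0)
  -- The approximation improves with `n`, so the test functions `φ n` remain bounded in `H¹` and
  -- weakly null.
  have hex : ∀ n : ℕ, ∃ φ : L2 d F, IsTest φ ∧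
      ‖lapPow lam (1 / 2) (χ n - φ)‖ < 1 / ((n : ℝ) + 1) := fun n =>
    exists_test_approx hlam (hχ n) (by positivity)
  choose φ hφ hle using hex
  have hφ1 : ∀ n, IsH1 (φ n) := fun n => by
    obtain ⟨g, hg⟩ := (isTest_iff _).1 (hφ n); exact hg.isH1
  have hle1 : ∀ n, ‖lapPow lam (1 / 2) (χ n - φ n)‖ ≤ 1 := fun n =>
    (hle n).le.trans (by rw [div_le_one (by positivity)]; simp)
  have hone : Tendsto (fun n : ℕ => 1 / ((n : ℝ) + 1)) atTop (𝓝 0) :=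
    tendsto_one_div_add_atTop_nhds_zero_nat
  have hMφ : ∀ n, ‖lapPow lam (1 / 2) (φ n)‖ ≤ M + 1 := fun n => by
    have h1 : lapPow lam (1 / 2) (φ n) =
        lapPow lam (1 / 2) (χ n) - lapPow lam (1 / 2) (χ n - φ n) := by
      rw [lapPow_sub hlam le_rfl (hχ n) (hφ1 n)]; abel
    rw [h1]
    exact (norm_sub_le _ _).trans (add_le_add (hM n) (hle1 n))
  have hwφ : WeakNull φ := fun f => by
    have h1 : ∀ n, inner ℂ f (φ n) = inner ℂ f (χ n) - inner ℂ f (χ n - φ n) := fun n => by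
      rw [inner_sub_right]; ring
    simp_rw [h1]
    rw [← sub_zero (0 : ℂ)]
    refine (hw f).sub ?_
    refine squeeze_zero_norm
      (a := fun n : ℕ => ‖f‖ * (lam ^ (-(1 / 2) : ℝ) * (1 / ((n : ℝ) + 1)))) (fun n => ?_) ?_
    · refine (norm_inner_le_norm _ _).trans ?_
      gcongr
      exact (norm_le_lapPow hlam ((hχ n).sub (hφ1 n))).trans (by gcongr; exact (hle n).le)
    · simpa using (hone.const_mul _).const_mul ‖f‖
  rw [Metric.tendsto_atTop]
  intro ε hε
  obtain ⟨ρ, hρ, hρle⟩ := exists_test_approx hlam hψ (ε := ε / (3 * (K * (M + 1) + 1)))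
    (by positivity)
  have hρ1 : IsH1 ρ := by obtain ⟨g, hg⟩ := (isTest_iff _).1 hρ; exact hg.isH1
  have ht1 := AdmissibleForm.tendsto_test hlam hδ hδ' hv hφ hρ hwφ hMφ
  have ht2 : Tendsto (fun n : ℕ => K * (1 / ((n : ℝ) + 1) * ‖lapPow lam (1 / 2) ψ‖)) atTop (𝓝 0) := by
    simpa using (hone.mul_const ‖lapPow lam (1 / 2) ψ‖).const_mul K
  obtain ⟨N1, hN1⟩ := Metric.tendsto_atTop.1 ht1 (ε / 3) (by positivity)
  obtain ⟨N2, hN2⟩ := Metric.tendsto_atTop.1 ht2 (ε / 3) (by positivity)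
  refine ⟨max N1 N2, fun n hn => ?_⟩
  have h1 := hN1 n (le_of_max_le_left hn)
  have h2 := hN2 n (le_of_max_le_right hn)
  rw [dist_zero_right] at h1 h2 ⊢
  have h2' := (le_abs_self _).trans_lt h2
  -- The first term vanishes by `tendsto_test`, the second is small uniformly in `n`, the third is
  -- of order `1 / (n + 1)`.
  have hdec : v n (χ n) ψ = v n (φ n) ρ + v n (φ n) (ψ - ρ) + v n (χ n - φ n) ψ := by
    rw [(hv n).sub_right _ _ _ (hφ1 n) hψ hρ1, (hv n).sub_left _ _ _ (hχ n) (hφ1 n) hψ]; ring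
  have h3 : ‖v n (φ n) (ψ - ρ)‖ ≤ ε / 3 := by
    calc _ ≤ K * (‖lapPow lam (1 / 2) (φ n)‖ * ‖lapPow lam (1 / 2) (ψ - ρ)‖) :=
          (hv n).bound _ _ (hφ1 n) (hψ.sub hρ1)
      _ ≤ K * ((M + 1) * (ε / (3 * (K * (M + 1) + 1)))) := by
          gcongr
          exact hMφ n
      _ ≤ ε / 3 := by
          rw [← mul_assoc, mul_div_assoc', div_le_div_iff₀ (by positivity) (by positivity)]
          nlinarith [mul_nonneg hK (by linarith : 0 ≤ M + 1)]
  have h4 : ‖v n (χ n - φ n) ψ‖ ≤ K * (1 / ((n : ℝ) + 1) * ‖lapPow lam (1 / 2) ψ‖) := by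
    refine ((hv n).bound _ _ ((hχ n).sub (hφ1 n)) hψ).trans ?_
    gcongr
    exact (hle n).le
  rw [hdec]
  calc _ ≤ ‖v n (φ n) ρ‖ + ‖v n (φ n) (ψ - ρ)‖ + ‖v n (χ n - φ n) ψ‖ := norm_add₃_le
    _ < ε := by linarith

end Admissible

/-! ### Weighted `L²` pairings along weakly null sequences. -/

section Weighted

variable {d : ℕ} {F : Type} [NormedAddCommGroup F] [InnerProductSpace ℂ F]

theorem mul_norm_mul_le {t : ℝ} (ht : 0 < t) (w : ℝ) (a b : F) :
    ‖(w : ℂ) * inner ℂ a b‖ ≤ t⁻¹ / 2 * (|w| * ‖a‖ ^ 2) + t / 2 * (|w| * ‖b‖ ^ 2) := by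
  rw [norm_mul, Complex.norm_real, Real.norm_eq_abs]
  have h1 : ‖inner ℂ a b‖ ≤ ‖a‖ * ‖b‖ := norm_inner_le_norm a b
  have h2 : ‖a‖ * ‖b‖ ≤ t⁻¹ / 2 * ‖a‖ ^ 2 + t / 2 * ‖b‖ ^ 2 := by
    have h4 : 0 ≤ t⁻¹ * (‖a‖ - t * ‖b‖) ^ 2 := by positivity
    have h5 : t⁻¹ * (‖a‖ - t * ‖b‖) ^ 2 = t⁻¹ * ‖a‖ ^ 2 + t * ‖b‖ ^ 2 - 2 * (‖a‖ * ‖b‖) := by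
      field_simp; ring
    linarith
  calc _ ≤ |w| * (t⁻¹ / 2 * ‖a‖ ^ 2 + t / 2 * ‖b‖ ^ 2) := by gcongr; linarith
    _ = _ := by ring

theorem integrable_weighted_inner {w : X d → ℝ} (hw : Measurable w) {a b : L2 d F}
    (ha : Integrable (fun x => |w x| * ‖a x‖ ^ 2) volume)
    (hb : Integrable (fun x => |w x| * ‖b x‖ ^ 2) volume) :
    Integrable (fun x => (w x : ℂ) * inner ℂ (a x) (b x)) volume := by
  refine ((ha.const_mul (1⁻¹ / 2)).add (hb.const_mul (1 / 2))).mono' ?_ (ae_of_all _ fun x => ?_)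
  · exact (Complex.measurable_ofReal.comp hw).aestronglyMeasurable.mul
      ((Lp.aestronglyMeasurable a).inner (Lp.aestronglyMeasurable b))
  · exact mul_norm_mul_le one_pos _ _ _

/-- Where `|w| ≤ k` the function `w ψ` is in `L²` and weak convergence applies. The rest is small by
Cauchy–Schwarz, since the weighted norms of `χ n` are bounded. It is used with `w = U` in space and
with `|2πξⱼ|²` in frequency. -/
theorem tendsto_weighted_inner {w : X d → ℝ} (hw : Measurable w) {χ : ℕ → L2 d F}
    (hχ : WeakNull χ) {ψ : L2 d F} {M : ℝ}
    (hi : ∀ n, Integrable (fun x => |w x| * ‖χ n x‖ ^ 2) volume)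
    (hM : ∀ n, ∫ x, |w x| * ‖χ n x‖ ^ 2 ≤ M)
    (hψ : Integrable (fun x => |w x| * ‖ψ x‖ ^ 2) volume) :
    Tendsto (fun n => ∫ x, (w x : ℂ) * inner ℂ (ψ x) (χ n x)) atTop (𝓝 0) := by
  have hM0 : 0 ≤ M := (integral_nonneg fun x => by positivity).trans (hM 0)
  set S : ℕ → Set (X d) := fun k => {x | |w x| ≤ k} with hS
  have hSm : ∀ k, MeasurableSet (S k) := fun k => measurableSet_le hw.abs measurable_const
  have hrest : Tendsto (fun k => ∫ x in (S k)ᶜ, |w x| * ‖ψ x‖ ^ 2) atTop (𝓝 0) := by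
    simp_rw [← fun k => integral_indicator (μ := volume) (f := fun x => |w x| * ‖ψ x‖ ^ 2)
      (hSm k).compl]
    have := tendsto_integral_of_dominated_convergence (μ := volume)
      (F := fun k => (S k)ᶜ.indicator fun x => |w x| * ‖ψ x‖ ^ 2) (f := fun _ => (0 : ℝ)) _
      (fun k => (hψ.indicator (hSm k).compl).aestronglyMeasurable) hψ
      (fun k => ae_of_all _ fun x => by
        refine (norm_indicator_le_norm_self _ _).trans ?_
        rw [Real.norm_of_nonneg (by positivity)])
      (ae_of_all _ fun x => by
        obtain ⟨N, hN⟩ := exists_nat_ge |w x|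
        refine tendsto_const_nhds.congr' ?_
        filter_upwards [eventually_ge_atTop N] with k hk
        rw [Set.indicator_of_notMem]
        simp only [hS, Set.mem_compl_iff, Set.mem_ofPred_eq, not_not]
        exact hN.trans (by exact_mod_cast hk))
    simpa using this
  have hcut : ∀ k, Tendsto (fun n => ∫ x in S k, (w x : ℂ) * inner ℂ (ψ x) (χ n x)) atTop (𝓝 0) := by
    intro k
    have hmem : MemLp (fun x => (S k).indicator (fun x => (w x : ℂ)) x • ψ x) 2 volume := by
      refine MemLp.of_le_mul (c := k) (Lp.memLp ψ) ?_ (ae_of_all _ fun x => ?_)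
      · exact ((Complex.measurable_ofReal.comp hw).indicator (hSm k)).aestronglyMeasurable.smul
          (Lp.aestronglyMeasurable ψ)
      · rw [norm_smul]
        gcongr
        by_cases hx : x ∈ S k
        · rw [Set.indicator_of_mem hx, Complex.norm_real]; exact hx
        · rw [Set.indicator_of_notMem hx, norm_zero]; positivity
    refine (hχ (hmem.toLp _)).congr fun n => ?_
    rw [L2.inner_def, ← integral_indicator (hSm k)]
    refine integral_congr_ae ?_
    filter_upwards [hmem.coeFn_toLp] with x hx
    rw [hx, inner_smul_left]
    by_cases hxs : x ∈ S k
    · rw [Set.indicator_of_mem hxs, Set.indicator_of_mem hxs, Complex.conj_ofReal]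
    · rw [Set.indicator_of_notMem hxs, Set.indicator_of_notMem hxs, map_zero, zero_mul]
  rw [Metric.tendsto_atTop]
  intro ε hε
  -- With this weight the `χ n` half of Young's inequality is at most `ε / 2`; then `k` makes the
  -- `ψ` half at most `ε / 8`.
  set t : ℝ := ε / (M + 1) with ht
  have ht0 : 0 < t := by positivity
  obtain ⟨k, hk⟩ := ((Metric.tendsto_atTop.1 hrest) (ε / 4 * t) (by positivity))
  have hk := hk k le_rfl
  obtain ⟨N, hN⟩ := (Metric.tendsto_atTop.1 (hcut k)) (ε / 4) (by positivity)
  refine ⟨N, fun n hn => ?_⟩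
  have h1 := hN n hn
  rw [dist_zero_right] at h1 hk ⊢
  have hk' := (le_abs_self _).trans_lt hk
  rw [← integral_add_compl (hSm k) (integrable_weighted_inner hw hψ (hi n))]
  have h2 : ‖∫ x in (S k)ᶜ, (w x : ℂ) * inner ℂ (ψ x) (χ n x)‖ ≤
      t⁻¹ / 2 * (∫ x in (S k)ᶜ, |w x| * ‖ψ x‖ ^ 2) + t / 2 * M := by
    refine (norm_integral_le_of_norm_le
      (((hψ.const_mul (t⁻¹ / 2)).add ((hi n).const_mul (t / 2))).integrableOn)
      (ae_of_all _ fun x => mul_norm_mul_le ht0 _ _ _)).trans ?_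
    simp only [Pi.add_apply]
    rw [integral_add (hψ.const_mul _).integrableOn ((hi n).const_mul _).integrableOn,
      integral_const_mul, integral_const_mul]
    gcongr
    exact (setIntegral_le_integral (hi n) (ae_of_all _ fun x => by positivity)).trans (hM n)
  have h3 : t⁻¹ / 2 * (∫ x in (S k)ᶜ, |w x| * ‖ψ x‖ ^ 2) ≤ ε / 8 := by
    calc _ ≤ t⁻¹ / 2 * (ε / 4 * t) := by gcongr
      _ = ε / 8 := by field_simp; ring
  have h4 : t / 2 * M ≤ ε / 2 := by
    rw [ht, div_div, div_mul_eq_mul_div, div_le_div_iff₀ (by positivity) (by positivity)]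
    nlinarith
  calc _ ≤ _ := norm_add_le _ _
    _ < ε := by linarith

end Weighted

/-! ### The form of `-Δ + U` on its domain. -/

section FreeForm

variable {d : ℕ} {F : Type} [NormedAddCommGroup F] [InnerProductSpace ℂ F] [CompleteSpace F]
  [FiniteDimensional ℂ F]

/-- The form bound of `U₋` for vector-valued functions. -/
theorem AssumptionU.exists_form_bound {U : X d → ℝ} (hU : AssumptionU U) :
    ∃ a b : ℝ, a < 1 ∧ 0 ≤ b ∧ ∀ ψ : L2 d F, IsH1 ψ →
      Integrable (fun x => max (-U x) 0 * ‖ψ x‖ ^ 2) volume ∧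
      ∫ x, max (-U x) 0 * ‖ψ x‖ ^ 2 ≤ a * ∑ j, ‖partialD j ψ‖ ^ 2 + b * ‖ψ‖ ^ 2 := by
  obtain ⟨-, -, a, b, ha0, ha1, h⟩ := hU
  refine ⟨a, |b|, ha1, abs_nonneg b, fun ψ hψ => ?_⟩
  -- The scalar bound is summed over components in an orthonormal basis; all the terms are sums of
  -- squares that split accordingly.
  set e := stdOrthonormalBasis ℂ F
  let T : Fin (Module.finrank ℂ F) → F →L[ℂ] ℂ := fun i => innerSL ℂ (e i)
  have hparts : ∀ φ : L2 d F, ∀ᵐ x, ‖φ x‖ ^ 2 = ∑ i, ‖((T i).compLp φ : L2 d ℂ) x‖ ^ 2 := by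
    intro φ
    have : ∀ᵐ x, ∀ i, ((T i).compLp φ : L2 d ℂ) x = T i (φ x) :=
      ae_all_iff.2 fun i => (T i).coeFn_compLp φ
    filter_upwards [this] with x hx
    simp_rw [hx, T, innerSL_apply_apply]
    rw [e.sum_sq_norm_inner_right]
  have hnorm : ∀ φ : L2 d F, ‖φ‖ ^ 2 = ∑ i, ‖((T i).compLp φ : L2 d ℂ)‖ ^ 2 := by
    intro φ
    simp_rw [norm_sq_eq_integral]
    rw [← integral_finsetSum _ fun i _ => integrable_norm_sq _]
    exact integral_congr_ae (hparts φ)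
  have hi := fun i => (h ((T i).compLp ψ) (hψ.compLp (T i))).1
  have hb := fun i => (h ((T i).compLp ψ) (hψ.compLp (T i))).2
  have hae : (fun x => max (-U x) 0 * ‖ψ x‖ ^ 2) =ᵐ[volume]
      fun x => ∑ i, max (-U x) 0 * ‖((T i).compLp ψ : L2 d ℂ) x‖ ^ 2 := by
    filter_upwards [hparts ψ] with x hx
    rw [hx, Finset.mul_sum]
  refine ⟨(integrable_finsetSum _ fun i _ => hi i).congr hae.symm, ?_⟩
  rw [integral_congr_ae hae, integral_finsetSum _ fun i _ => hi i]
  calc _ ≤ ∑ i, (a * ∑ j, ‖partialD j ((T i).compLp ψ : L2 d ℂ)‖ ^ 2 +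
        b * ‖((T i).compLp ψ : L2 d ℂ)‖ ^ 2) := Finset.sum_le_sum fun i _ => hb i
    _ = a * ∑ j, ‖partialD j ψ‖ ^ 2 + b * ‖ψ‖ ^ 2 := by
        rw [Finset.sum_add_distrib, ← Finset.mul_sum, ← Finset.mul_sum, ← hnorm, Finset.sum_comm]
        congr 2
        refine Finset.sum_congr rfl fun j _ => ?_
        rw [hnorm (partialD j ψ)]
        refine Finset.sum_congr rfl fun i _ => ?_
        rw [partialD_eq, partialD_eq, mult_compLp (hψ.inDom_derivSym j)]
    _ ≤ _ := by gcongr; exact le_abs_self b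

theorem InQ.integrable_abs {U : X d → ℝ} (hU : AssumptionU U) {ψ : L2 d F} (hψ : InQ U ψ) :
    Integrable (fun x => |U x| * ‖ψ x‖ ^ 2) volume := by
  obtain ⟨a, b, -, -, h⟩ := hU.exists_form_bound (F := F)
  refine (hψ.2.add (h ψ hψ.1).1).congr (ae_of_all _ fun x => ?_)
  simp only [Pi.add_apply]
  rw [← add_mul, ← max_zero_add_max_neg_zero_eq_abs_self]

omit [FiniteDimensional ℂ F] in
theorem InQ.sub {U : X d → ℝ} (hU : AssumptionU U) {a b : L2 d F} (ha : InQ U a) (hb : InQ U b) :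
    InQ U (a - b) := by
  refine ⟨ha.1.sub hb.1, ?_⟩
  refine ((ha.2.const_mul 2).add (hb.2.const_mul 2)).mono' ?_ ?_
  · exact (hU.1.max measurable_const).aestronglyMeasurable.mul
      ((Lp.aestronglyMeasurable (a - b)).norm.pow 2)
  · filter_upwards [Lp.coeFn_sub a b] with x hx
    rw [hx, Pi.sub_apply, Real.norm_of_nonneg (by positivity)]
    have h1 : ‖a x - b x‖ ^ 2 ≤ 2 * ‖a x‖ ^ 2 + 2 * ‖b x‖ ^ 2 := by
      have := norm_sub_le (a x) (b x)
      have h0 := norm_nonneg (a x - b x)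
      nlinarith [sq_nonneg (‖a x‖ - ‖b x‖)]
    calc _ ≤ max (U x) 0 * (2 * ‖a x‖ ^ 2 + 2 * ‖b x‖ ^ 2) := by gcongr
      _ = _ := by simp only [Pi.add_apply]; ring

theorem freeForm_sub_right {U : X d → ℝ} (hU : AssumptionU U) {a b c : L2 d F} (ha : InQ U a)
    (hb : InQ U b) (hc : InQ U c) :
    freeForm U a (b - c) = freeForm U a b - freeForm U a c := by
  have h1 : ∫ x, (U x : ℂ) * inner ℂ (a x) ((b - c : L2 d F) x) =
      (∫ x, (U x : ℂ) * inner ℂ (a x) (b x)) - ∫ x, (U x : ℂ) * inner ℂ (a x) (c x) := by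
    rw [← integral_sub
      (integrable_weighted_inner hU.1 (ha.integrable_abs hU) (hb.integrable_abs hU))
      (integrable_weighted_inner hU.1 (ha.integrable_abs hU) (hc.integrable_abs hU))]
    refine integral_congr_ae ?_
    filter_upwards [Lp.coeFn_sub b c] with x hx
    rw [hx, Pi.sub_apply, inner_sub_right, mul_sub]
  unfold freeForm
  simp_rw [partialD_sub _ hb.1 hc.1, inner_sub_right, Finset.sum_sub_distrib, h1]
  ring

omit [FiniteDimensional ℂ F] in
theorem freeForm_conj (U : X d → ℝ) (a b : L2 d F) :
    starRingEnd ℂ (freeForm U a b) = freeForm U b a := by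
  unfold freeForm
  rw [map_add, map_sum, ← integral_conj]
  simp_rw [map_mul, inner_conj_symm, Complex.conj_ofReal]

theorem freeForm_sub_left {U : X d → ℝ} (hU : AssumptionU U) {a b c : L2 d F} (ha : InQ U a)
    (hb : InQ U b) (hc : InQ U c) :
    freeForm U (a - b) c = freeForm U a c - freeForm U b c := by
  rw [← freeForm_conj, freeForm_sub_right hU hc ha hb, map_sub, freeForm_conj, freeForm_conj]

theorem freeForm_self_re {U : X d → ℝ} (hU : AssumptionU U) {ψ : L2 d F} (hψ : InQ U ψ) :
    (freeForm U ψ ψ).re = ∑ j, ‖partialD j ψ‖ ^ 2 + (∫ x, max (U x) 0 * ‖ψ x‖ ^ 2) -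
      ∫ x, max (-U x) 0 * ‖ψ x‖ ^ 2 := by
  obtain ⟨a, b, -, -, h⟩ := hU.exists_form_bound (F := F)
  have h1 : ∀ x, (U x : ℂ) * inner ℂ (ψ x) (ψ x) =
      ((max (U x) 0 * ‖ψ x‖ ^ 2 - max (-U x) 0 * ‖ψ x‖ ^ 2 : ℝ) : ℂ) := fun x => by
    rw [inner_self_eq_norm_sq_to_K, ← sub_mul]
    have : max (U x) 0 - max (-U x) 0 = U x := by
      rcases le_total 0 (U x) with h | h
      · rw [max_eq_left h, max_eq_right (by linarith)]; ring
      · rw [max_eq_right h, max_eq_left (by linarith)]; ring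
    rw [this]
    push_cast
    rfl
  unfold freeForm
  simp_rw [h1]
  rw [integral_complex_ofReal, integral_sub hψ.2 (h ψ hψ.1).1]
  simp_rw [inner_self_eq_norm_sq_to_K]
  rw [Complex.add_re, Complex.ofReal_re, Complex.re_sum, add_sub_assoc]
  congr 1
  refine Finset.sum_congr rfl fun j _ => ?_
  norm_cast

/-- Both parts are weighted pairings: the kinetic one after Plancherel, where the Fourier transforms
are again weakly null, and the potential one directly. -/
theorem tendsto_freeForm {U : X d → ℝ} (hU : AssumptionU U) {χ : ℕ → L2 d F}
    (hχ : WeakNull χ) (hχQ : ∀ n, InQ U (χ n)) {ψ : L2 d F} (hψ : InQ U ψ) {M : ℝ}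
    (hM : ∀ n, ∑ j, ‖partialD j (χ n)‖ ^ 2 ≤ M)
    (hM' : ∀ n, ∫ x, |U x| * ‖χ n x‖ ^ 2 ≤ M) :
    Tendsto (fun n => freeForm U ψ (χ n)) atTop (𝓝 0) := by
  have hF : WeakNull (fun n => (𝓕 (χ n) : L2 d F)) := fun φ => by
    have h1 : ∀ n, inner ℂ φ (𝓕 (χ n) : L2 d F) = inner ℂ (𝓕⁻ φ : L2 d F) (χ n) := fun n => by
      rw [← Lp.inner_fourier_eq (𝓕⁻ φ : L2 d F) (χ n), FourierTransform.fourier_fourierInv_eq]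
    simp_rw [h1]
    exact hχ _
  have hj : ∀ j, Tendsto (fun n => inner ℂ (partialD j ψ) (partialD j (χ n))) atTop (𝓝 0) := by
    intro j
    have habs : ∀ ξ : X d, |‖derivSym j ξ‖ ^ 2| = ‖derivSym j ξ‖ ^ 2 := fun ξ =>
      abs_of_nonneg (by positivity)
    have := tendsto_weighted_inner (w := fun ξ => ‖derivSym j ξ‖ ^ 2)
      ((measurable_derivSym j).norm.pow_const 2) hF (ψ := (𝓕 ψ : L2 d F)) (M := M)
      (fun n => by simp_rw [habs]; exact ((hχQ n).1.inDom_derivSym j).integrable)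
      (fun n => by
        simp_rw [habs]
        rw [← norm_mult_sq ((hχQ n).1.inDom_derivSym j)]
        refine le_trans ?_ (hM n)
        exact Finset.single_le_sum (f := fun j => ‖partialD j (χ n)‖ ^ 2)
          (fun i _ => sq_nonneg _) (Finset.mem_univ j))
      (by simp_rw [habs]; exact (hψ.1.inDom_derivSym j).integrable)
    refine this.congr fun n => ?_
    rw [partialD_eq, partialD_eq, inner_mult (hψ.1.inDom_derivSym j) ((hχQ n).1.inDom_derivSym j)]
  have hV := tendsto_weighted_inner hU.1 hχ (ψ := ψ) (M := M)
    (fun n => (hχQ n).integrable_abs hU) hM' (hψ.integrable_abs hU)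
  have := (tendsto_finsetSum Finset.univ fun j _ => hj j).add hV
  simpa [freeForm] using this

end FreeForm

/-! ### Coercivity and the lower bound for admissible perturbations. -/

section Gamma

variable {d : ℕ} {F : Type} [NormedAddCommGroup F] [InnerProductSpace ℂ F] [CompleteSpace F]
  [FiniteDimensional ℂ F]

/-- Coercivity of the energies, uniformly in `n`. -/
theorem exists_coercive {U : X d → ℝ} (hU : AssumptionU U) {lam : ℝ} (hlam : 0 < lam) {δ : ℝ}
    (hδ : 0 < δ) (hδ' : δ < 1 / 2) {K : ℝ} (hK : 0 ≤ K) {v : ℕ∞ → L2 d F → L2 d F → ℂ}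
    (hv : ∀ n, AdmissibleForm lam δ K (v n)) :
    ∃ κ C : ℝ, 0 < κ ∧ ∀ (n : ℕ∞) (ψ : L2 d F), InQ U ψ →
      κ * ∑ j, ‖partialD j ψ‖ ^ 2 + (∫ x, max (U x) 0 * ‖ψ x‖ ^ 2) ≤
        energy U v 0 n ψ + C * ‖ψ‖ ^ 2 := by
  obtain ⟨a, b, ha, hb, h⟩ := hU.exists_form_bound (F := F)
  obtain ⟨C, hC0, hC⟩ := AdmissibleForm.exists_diag_bound (d := d) (F := F) hlam hδ hδ' hK
    -- `U₋` leaves the fraction `1 - a` of the kinetic energy; the perturbation may use half of it.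
    (ε := (1 - a) / 2) (by linarith)
  refine ⟨(1 - a) / 2, C + b, by linarith, fun n ψ hψ => ?_⟩
  have h1 := (h ψ hψ.1).2
  have h2 := hC (v n) (hv n) ψ hψ.1
  have h3 := (abs_le.1 ((Complex.abs_re_le_norm (v n ψ ψ)).trans h2)).1
  unfold energy
  rw [Complex.add_re, freeForm_self_re hU hψ]
  nlinarith

omit [FiniteDimensional ℂ F] in
-- Uniform boundedness, applied to the functionals `inner ℂ (χ n)`.
theorem WeakNull.exists_bound {χ : ℕ → L2 d F} (h : WeakNull χ) : ∃ M : ℝ, ∀ n, ‖χ n‖ ≤ M := by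
  obtain ⟨M, hM⟩ := banach_steinhaus (g := fun n => innerSL ℂ (χ n)) fun φ => by
    obtain ⟨B, hB⟩ := (h φ).norm.bddAbove_range
    refine ⟨B, fun n => ?_⟩
    rw [innerSL_apply_apply, norm_inner_symm]
    exact hB ⟨n, rfl⟩
  exact ⟨M, fun n => by simpa using hM n⟩

/-- Expansion of the energy around `ψ`. -/
theorem energy_add {U : X d → ℝ} (hU : AssumptionU U) {lam δ K : ℝ}
    {v : ℕ∞ → L2 d F → L2 d F → ℂ} {n : ℕ∞} (hv : AdmissibleForm lam δ K (v n)) (μ : ℝ)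
    {φ ψ : L2 d F} (hφ : InQ U φ) (hψ : InQ U ψ) :
    energy U v μ n φ = energy U v μ n (φ - ψ) + energy U v μ n ψ +
      ((freeForm U ψ (φ - ψ)).re * 2 + (v n (φ - ψ) ψ + v n ψ (φ - ψ)).re +
        2 * μ * (inner ℂ ψ (φ - ψ)).re) := by
  have hχ := hφ.sub hU hψ
  have e1 : freeForm U (φ - ψ) (φ - ψ) = freeForm U φ φ - freeForm U ψ φ -
      (freeForm U φ ψ - freeForm U ψ ψ) := by
    rw [freeForm_sub_right hU hχ hφ hψ, freeForm_sub_left hU hφ hψ hφ,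
      freeForm_sub_left hU hφ hψ hψ]
  have e2 := freeForm_sub_right hU hψ hφ hψ
  have e3 : (freeForm U φ ψ).re = (freeForm U ψ φ).re := by
    rw [← freeForm_conj, Complex.conj_re]
  have e4 : v n (φ - ψ) (φ - ψ) = v n φ φ - v n ψ φ - (v n φ ψ - v n ψ ψ) := by
    rw [hv.sub_right _ _ _ hχ.1 hφ.1 hψ.1, hv.sub_left _ _ _ hφ.1 hψ.1 hφ.1,
      hv.sub_left _ _ _ hφ.1 hψ.1 hψ.1]
  have e5 := hv.sub_left _ _ _ hφ.1 hψ.1 hψ.1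
  have e6 := hv.sub_right _ _ _ hψ.1 hφ.1 hψ.1
  have e7 : ‖φ - ψ‖ ^ 2 = ‖φ‖ ^ 2 - 2 * (inner ℂ ψ φ).re + ‖ψ‖ ^ 2 := by
    rw [norm_sub_rev, @norm_sub_sq ℂ]; simp; ring
  have e8 : (inner ℂ ψ (φ - ψ)).re = (inner ℂ ψ φ).re - ‖ψ‖ ^ 2 := by
    rw [inner_sub_right, Complex.sub_re, inner_self_eq_norm_sq_to_K]; norm_cast
  unfold energy
  rw [e1, e2, e4, e5, e6, e7, e8]
  simp only [Complex.add_re, Complex.sub_re, e3]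
  ring

/-- Coercivity controls the kinetic and the `U₊` part of `φ n`, hence of the difference; `U₋` is
then controlled by its form bound. One `M` supplies all the hypotheses of the cross-term lemmas. -/
theorem exists_bound_sub {U : X d → ℝ} (hU : AssumptionU U) {lam : ℝ} (hlam : 0 < lam)
    {φ : ℕ → L2 d F} (hφ : ∀ n, InQ U (φ n)) {ψ : L2 d F} (hψ : InQ U ψ) {κ E B : ℝ} (hκ : 0 < κ)
    (hE : ∀ n, κ * ∑ j, ‖partialD j (φ n)‖ ^ 2 + (∫ x, max (U x) 0 * ‖φ n x‖ ^ 2) ≤ E)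
    (hB : ∀ n, ‖φ n - ψ‖ ≤ B) :
    ∃ M : ℝ, ∀ n, ∑ j, ‖partialD j (φ n - ψ)‖ ^ 2 ≤ M ∧
      ∫ x, |U x| * ‖(φ n - ψ : L2 d F) x‖ ^ 2 ≤ M ∧ ‖lapPow lam (1 / 2) (φ n - ψ)‖ ≤ M := by
  obtain ⟨a, b, ha, hb, hform⟩ := hU.exists_form_bound (F := F)
  set D : ℝ := 2 * (E / κ) + 2 * ∑ j, ‖partialD j ψ‖ ^ 2 with hD
  set P : ℝ := 2 * E + 2 * ∫ x, max (U x) 0 * ‖ψ x‖ ^ 2 with hP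
  have hD0 : ∀ n, ∑ j, ‖partialD j (φ n - ψ)‖ ^ 2 ≤ D := fun n => by
    have h1 : ∑ j, ‖partialD j (φ n)‖ ^ 2 ≤ E / κ := by
      rw [le_div_iff₀ hκ, mul_comm]
      have h2 : 0 ≤ ∫ x, max (U x) 0 * ‖φ n x‖ ^ 2 := integral_nonneg fun x => by positivity
      linarith [hE n]
    calc _ ≤ ∑ j, (2 * ‖partialD j (φ n)‖ ^ 2 + 2 * ‖partialD j ψ‖ ^ 2) := by
          refine Finset.sum_le_sum fun j _ => ?_
          rw [partialD_sub j (hφ n).1 hψ.1]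
          have := norm_sub_le (partialD j (φ n)) (partialD j ψ)
          have h0 := norm_nonneg (partialD j (φ n) - partialD j ψ)
          nlinarith [sq_nonneg (‖partialD j (φ n)‖ - ‖partialD j ψ‖)]
      _ ≤ _ := by
          rw [Finset.sum_add_distrib, ← Finset.mul_sum, ← Finset.mul_sum, hD]
          gcongr
  have hP0 : ∀ n, ∫ x, max (U x) 0 * ‖(φ n - ψ : L2 d F) x‖ ^ 2 ≤ P := fun n => by
    have h1 : ∫ x, max (U x) 0 * ‖φ n x‖ ^ 2 ≤ E := by
      have h2 : 0 ≤ κ * ∑ j, ‖partialD j (φ n)‖ ^ 2 := by positivity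
      linarith [hE n]
    calc _ ≤ ∫ x, (2 * (max (U x) 0 * ‖φ n x‖ ^ 2) + 2 * (max (U x) 0 * ‖ψ x‖ ^ 2)) := by
          refine integral_mono_ae ((hφ n).sub hU hψ).2
            (((hφ n).2.const_mul 2).add (hψ.2.const_mul 2)) ?_
          filter_upwards [Lp.coeFn_sub (φ n) ψ] with x hx
          rw [hx, Pi.sub_apply]
          have h1 : ‖φ n x - ψ x‖ ^ 2 ≤ 2 * ‖φ n x‖ ^ 2 + 2 * ‖ψ x‖ ^ 2 := by
            have := norm_sub_le (φ n x) (ψ x)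
            have h0 := norm_nonneg (φ n x - ψ x)
            nlinarith [sq_nonneg (‖φ n x‖ - ‖ψ x‖)]
          calc _ ≤ max (U x) 0 * (2 * ‖φ n x‖ ^ 2 + 2 * ‖ψ x‖ ^ 2) := by gcongr
            _ = _ := by ring
      _ ≤ P := by
          rw [integral_add ((hφ n).2.const_mul 2) (hψ.2.const_mul 2), integral_const_mul,
            integral_const_mul, hP]
          gcongr
  have hB2 : ∀ n, ‖φ n - ψ‖ ^ 2 ≤ B ^ 2 := fun n => by gcongr; exact hB n
  have hUi : ∀ n, ∫ x, |U x| * ‖(φ n - ψ : L2 d F) x‖ ^ 2 ≤ P + (D + b * B ^ 2) := fun n => by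
    have hQ := (hφ n).sub hU hψ
    have h1 := hform _ hQ.1
    have h2 : ∀ x, |U x| * ‖(φ n - ψ : L2 d F) x‖ ^ 2 = max (U x) 0 * ‖(φ n - ψ : L2 d F) x‖ ^ 2 +
        max (-U x) 0 * ‖(φ n - ψ : L2 d F) x‖ ^ 2 := fun x => by
      rw [← add_mul, ← max_zero_add_max_neg_zero_eq_abs_self]
    simp_rw [h2]
    rw [integral_add hQ.2 h1.1]
    refine add_le_add (hP0 n) (h1.2.trans (add_le_add ?_ ?_))
    · refine le_trans ?_ (hD0 n)
      have h3 : 0 ≤ ∑ j, ‖partialD j (φ n - ψ)‖ ^ 2 := by positivity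
      nlinarith
    · exact mul_le_mul_of_nonneg_left (hB2 n) hb
  have hN : ∀ n, ‖lapPow lam (1 / 2) (φ n - ψ)‖ ≤ Real.sqrt (D + lam * B ^ 2) := fun n => by
    apply Real.le_sqrt_of_sq_le
    rw [norm_lapPow_half_sq hlam ((hφ n).1.sub hψ.1)]
    exact add_le_add (hD0 n) (mul_le_mul_of_nonneg_left (hB2 n) hlam.le)
  exact ⟨max D (max (P + (D + b * B ^ 2)) (Real.sqrt (D + lam * B ^ 2))), fun n =>
    ⟨(hD0 n).trans (le_max_left _ _), (hUi n).trans ((le_max_left _ _).trans (le_max_right _ _)),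
      (hN n).trans ((le_max_right _ _).trans (le_max_right _ _))⟩⟩

theorem weakGammaLowerBound_of_admissible {U : X d → ℝ} (hU : AssumptionU U) {lam : ℝ}
    (hlam : 0 < lam) {δ : ℝ} (hδ : 0 < δ) (hδ' : δ < 1 / 2) {K : ℝ} (hK : 0 ≤ K)
    {v : ℕ∞ → L2 d F → L2 d F → ℂ} (hv : ∀ n, AdmissibleForm lam δ K (v n))
    (hconv : WeakConv U v) : WeakGammaLowerBound U v lam := by
  obtain ⟨κ, C, hκ, hcoer⟩ := exists_coercive hU hlam hδ hδ' hK hv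
  refine ⟨⟨-C, fun n ψ hψ => ?_⟩, fun m hm μ hμ Ψ ψ hΨ hψ hweak => ?_⟩
  · have h1 := hcoer n ψ hψ
    have h2 : 0 ≤ ∫ x, max (U x) 0 * ‖ψ x‖ ^ 2 := integral_nonneg fun x => by positivity
    have h3 : 0 ≤ κ * ∑ j, ‖partialD j ψ‖ ^ 2 := by positivity
    linarith
  set χ : ℕ → L2 d F := fun n => Ψ n - ψ with hχ
  have hχQ : ∀ n, InQ U (χ n) := fun n => (hΨ n).sub hU hψ
  have hnull : WeakNull χ := fun φ => by
    have := (hweak φ).sub_const (inner ℂ φ ψ)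
    simpa [hχ, inner_sub_right] using this
  have henergy : ∀ (n : ℕ∞) (φ : L2 d F), energy U v μ n φ = energy U v 0 n φ + μ * ‖φ‖ ^ 2 :=
    fun n φ => by simp [energy]
  have hnonneg : ∀ n : ℕ∞, ∀ φ : L2 d F, InQ U φ → 0 ≤ energy U v μ n φ := fun n φ hφ => by
    have h1 := hm n φ hφ
    have h2 : -m < μ := (le_max_left _ _).trans_lt hμ
    rw [henergy]
    nlinarith [sq_nonneg ‖φ‖]
  refine le_of_forall_lt_imp_le_of_dense fun c' hc' => ?_
  obtain ⟨c, hc1, hc2⟩ := EReal.lt_iff_exists_real_btwn.1 hc'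
  refine hc1.le.trans (le_liminf_of_le (by isBoundedDefault) ?_)
  have hc2' : c < energy U v μ ⊤ ψ := by exact_mod_cast hc2
  -- Failure yields a subsequence with energies below `c`. Only there is an `H¹` bound available.
  by_contra hnot
  rw [not_eventually] at hnot
  obtain ⟨σ, hσ, hσlt⟩ := extraction_of_frequently_atTop hnot
  have hlt : ∀ k, energy U v μ (σ k : ℕ∞) (Ψ (σ k)) < c := fun k => by
    have := hσlt k
    rw [not_le] at this
    exact_mod_cast this
  have hσt := hσ.tendsto_atTop
  have hnull' : WeakNull (fun k => χ (σ k)) := fun φ => (hnull φ).comp hσt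
  obtain ⟨B, hB⟩ := hnull.exists_bound
  have hB0 : 0 ≤ B := (norm_nonneg _).trans (hB 0)
  have hΨB : ∀ n, ‖Ψ n‖ ^ 2 ≤ (B + ‖ψ‖) ^ 2 := fun n => by
    have : ‖Ψ n‖ ≤ B + ‖ψ‖ := by
      calc ‖Ψ n‖ = ‖χ n + ψ‖ := by simp [hχ]
        _ ≤ _ := (norm_add_le _ _).trans (by gcongr; exact hB n)
    gcongr
  set E : ℝ := c + (|C| + |μ|) * (B + ‖ψ‖) ^ 2 with hE
  have hkin : ∀ k, κ * ∑ j, ‖partialD j (Ψ (σ k))‖ ^ 2 +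
      (∫ x, max (U x) 0 * ‖Ψ (σ k) x‖ ^ 2) ≤ E := fun k => by
    have h1 := hcoer (σ k) (Ψ (σ k)) (hΨ _)
    have h2 := hlt k
    rw [henergy] at h2
    have h3 : (C - μ) * ‖Ψ (σ k)‖ ^ 2 ≤ (|C| + |μ|) * (B + ‖ψ‖) ^ 2 := by
      calc _ ≤ (|C| + |μ|) * ‖Ψ (σ k)‖ ^ 2 := by
            gcongr
            have := le_abs_self C
            have := neg_abs_le μ
            linarith
        _ ≤ _ := mul_le_mul_of_nonneg_left (hΨB _) (by positivity)
    rw [hE]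
    linarith
  obtain ⟨M, hM⟩ := exists_bound_sub hU hlam (fun k => hΨ (σ k)) hψ hκ hkin
    (fun k => hB (σ k))
  have hQ' : ∀ k, InQ U (χ (σ k)) := fun k => hχQ (σ k)
  have hfree := tendsto_freeForm hU hnull' hQ' hψ (fun k => (hM k).1) (fun k => (hM k).2.1)
  have hv1 := AdmissibleForm.tendsto_left hlam hδ hδ' hK (fun k => hv (σ k)) (fun k => (hQ' k).1)
    hψ.1 hnull' (fun k => (hM k).2.2)
  have hv2 := AdmissibleForm.tendsto_left hlam hδ hδ' hK (fun k => (hv (σ k)).swap)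
    (fun k => (hQ' k).1) hψ.1 hnull' (fun k => (hM k).2.2)
  -- The only place where `V_n → V_∞` enters.
  have hen : Tendsto (fun k => energy U v μ (σ k : ℕ∞) ψ) atTop (𝓝 (energy U v μ ⊤ ψ)) := by
    have h1 := (hconv ψ ψ hψ hψ).comp hσt
    have h2 := (Complex.continuous_re.tendsto _).comp (h1.const_add (freeForm U ψ ψ))
    exact h2.add_const (μ * ‖ψ‖ ^ 2)
  have hcross : Tendsto (fun k => energy U v μ (σ k : ℕ∞) ψ +
      ((freeForm U ψ (χ (σ k))).re * 2 + (v (σ k) (χ (σ k)) ψ + v (σ k) ψ (χ (σ k))).re +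
        2 * μ * (inner ℂ ψ (χ (σ k))).re)) atTop (𝓝 (energy U v μ ⊤ ψ)) := by
    have h1 := (Complex.continuous_re.tendsto _).comp hfree
    have h2 := (Complex.continuous_re.tendsto _).comp (hv1.add hv2)
    have h3 := (Complex.continuous_re.tendsto _).comp (hnull' ψ)
    have := hen.add (((h1.mul_const 2).add h2).add (h3.const_mul (2 * μ)))
    simpa using this
  -- For some `k` the expansion without the energy of `χ` already exceeds `c`; that energy is
  -- nonnegative, which contradicts `hlt`.
  obtain ⟨k, hk⟩ := (hcross.eventually (lt_mem_nhds hc2')).exists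
  have h1 := energy_add hU (hv (σ k)) μ (hΨ (σ k)) hψ
  have h2 := hnonneg (σ k) _ (hQ' k)
  have h3 := hlt k
  simp only [hχ] at hk h2
  linarith

end Gamma

/-! ### Potentials with a sandwich bound are admissible. -/

section Potential

variable {d : ℕ} {F : Type} [NormedAddCommGroup F] [InnerProductSpace ℂ F] [CompleteSpace F]

/-- The order-`δ` norm is at most `lam ^ (δ - 1 / 2)` times the `H¹` norm, so the left bound on `H¹`
yields the full and the diagonal bound. The right bound is asked only of test functions, where
integration by parts is available. -/
theorem AdmissibleForm.of_bounds {lam : ℝ} (hlam : 0 < lam) {δ : ℝ} (hδ' : δ < 1 / 2) {K : ℝ}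
    (hK : 0 ≤ K) {v : L2 d F → L2 d F → ℂ}
    (sub_left : ∀ a b c, IsH1 a → IsH1 b → IsH1 c → v (a - b) c = v a c - v b c)
    (sub_right : ∀ a b c, IsH1 a → IsH1 b → IsH1 c → v a (b - c) = v a b - v a c)
    (bound_left : ∀ a b, IsH1 a → IsH1 b →
      ‖v a b‖ ≤ K * (‖lapPow lam δ a‖ * ‖lapPow lam (1 / 2) b‖))
    (bound_right : ∀ a b, IsTest a → IsTest b →
      ‖v a b‖ ≤ K * (‖lapPow lam (1 / 2) a‖ * ‖lapPow lam δ b‖))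
    (eq_zero : ∀ a b g h, Represents g a → Represents h b → Disjoint (tsupport g) (tsupport h) →
      v a b = 0) :
    AdmissibleForm lam δ (K * (1 + lam ^ (δ - 1 / 2))) v := by
  set c : ℝ := lam ^ (δ - 1 / 2) with hc
  have hc0 : 0 ≤ c := by positivity
  have hKc : K ≤ K * (1 + c) := le_mul_of_one_le_right hK (by linarith)
  have hKc' : K * c ≤ K * (1 + c) := by gcongr; linarith
  have htest : ∀ a : L2 d F, IsTest a → IsH1 a := fun a ha => by
    obtain ⟨g, hg⟩ := (isTest_iff a).1 ha
    exact hg.isH1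
  refine ⟨sub_left, sub_right, fun a b ha hb => ?_, fun a b ha hb => ?_, fun a b ha hb => ?_,
    fun a ha => ?_, eq_zero⟩
  · calc _ ≤ K * (‖lapPow lam δ a‖ * ‖lapPow lam (1 / 2) b‖) := bound_left a b ha hb
      _ ≤ K * (c * ‖lapPow lam (1 / 2) a‖ * ‖lapPow lam (1 / 2) b‖) := by
          gcongr; exact norm_lapPow_le hlam hδ'.le ha
      _ = K * c * (‖lapPow lam (1 / 2) a‖ * ‖lapPow lam (1 / 2) b‖) := by ring
      _ ≤ _ := by gcongr
  · exact (bound_left a b (htest a ha) (htest b hb)).trans (by gcongr)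
  · exact (bound_right a b ha hb).trans (by gcongr)
  · exact (bound_left a a ha ha).trans (by gcongr)

theorem AdmissibleForm.mono {lam δ K K' : ℝ} {v : L2 d F → L2 d F → ℂ}
    (h : AdmissibleForm lam δ K v) (hK : K ≤ K') : AdmissibleForm lam δ K' v where
  sub_left := h.sub_left
  sub_right := h.sub_right
  bound a b ha hb := (h.bound a b ha hb).trans (by gcongr)
  bound_left a b ha hb := (h.bound_left a b ha hb).trans (by gcongr)
  bound_right a b ha hb := (h.bound_right a b ha hb).trans (by gcongr)
  bound_diag a ha := (h.bound_diag a ha).trans (by gcongr)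
  eq_zero := h.eq_zero

theorem inner_eq_zero_of_disjoint {E : Type} [NormedAddCommGroup E] [InnerProductSpace ℂ E]
    {g h : X d → E} (hd : Disjoint (tsupport g) (tsupport h)) (x : X d) :
    inner ℂ (g x) (h x) = 0 := by
  by_cases hx : x ∈ tsupport g
  · rw [image_eq_zero_of_notMem_tsupport (Set.disjoint_left.1 hd hx), inner_zero_right]
  · rw [image_eq_zero_of_notMem_tsupport hx, inner_zero_left]

omit [CompleteSpace F] in
theorem Represents.compLp {h : X d → F} {ψ : L2 d F} (hψ : Represents h ψ) (S : F →L[ℂ] F) :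
    Represents (fun x => S (h x)) (S.compLp ψ) where
  smooth := (S.restrictScalars ℝ).contDiff.comp hψ.smooth
  compact := hψ.compact.comp_left (map_zero S)
  ae_eq := by
    filter_upwards [S.coeFn_compLp ψ, hψ.ae_eq] with x h1 h2
    rw [h1, h2]

omit [CompleteSpace F] in
theorem compLp_sub (S : F →L[ℂ] F) (a b : L2 d F) :
    S.compLp (a - b) = S.compLp a - S.compLp b :=
  (S.compLpL 2 volume).map_sub a b

theorem norm_lapPow_compLp_le (S : F →L[ℂ] F) {lam : ℝ} (hlam : 0 < lam) {s : ℝ}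
    (hs : s ≤ 1 / 2) {a : L2 d F} (ha : IsH1 a) :
    ‖lapPow lam s (S.compLp a)‖ ≤ ‖S‖ * ‖lapPow lam s a‖ := by
  rw [lapPow_eq, mult_compLp (ha.inDom_lapSym hlam hs)]
  exact S.norm_compLp_le _

theorem SandwichBound.nonneg {lam δ C : ℝ} {w : X d → ℝ} (h : SandwichBound F lam δ C w) :
    0 ≤ C := (norm_nonneg _).trans h.2.2.2

theorem SandwichBound.isSandwich {lam δ C : ℝ} {w : X d → ℝ} (h : SandwichBound F lam δ C w) :
    IsSandwich lam δ w (sandwich lam δ w : L2 d F →L[ℂ] L2 d F) := by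
  obtain ⟨-, -, hex, -⟩ := h
  rw [sandwich, dif_pos hex]
  exact hex.choose_spec

/-- The form `⟨φ, w S ψ⟩` is admissible if `w` satisfies the sandwich bound and `S` is a matrix. -/
theorem admissibleForm_potForm_comp {lam : ℝ} (hlam : 0 < lam) {δ : ℝ} (hδ' : δ < 1 / 2)
    {C : ℝ} {w : X d → ℝ} (hw : SandwichBound F lam δ C w) (S : F →L[ℂ] F) :
    AdmissibleForm lam δ (C * ‖S‖ * lam ^ (δ - 1 / 2) * (1 + lam ^ (δ - 1 / 2)))
      (fun φ ψ : L2 d F => potForm lam δ w φ (S.compLp ψ)) := by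
  have hC := hw.nonneg
  set T : L2 d F →L[ℂ] L2 d F := sandwich lam δ w with hT
  have hkey : ∀ a b : L2 d F, IsH1 b → ‖potForm lam δ w a (S.compLp b)‖ ≤
      C * ‖S‖ * (‖lapPow lam δ a‖ * ‖lapPow lam δ b‖) := fun a b hb => by
    calc _ ≤ ‖lapPow lam δ a‖ * ‖T (lapPow lam δ (S.compLp b))‖ := norm_inner_le_norm _ _
      _ ≤ ‖lapPow lam δ a‖ * (C * (‖S‖ * ‖lapPow lam δ b‖)) := by
          gcongr
          refine (T.le_opNorm _).trans ?_
          gcongr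
          · exact hw.2.2.2
          · exact norm_lapPow_compLp_le S hlam hδ'.le hb
      _ = _ := by ring
  have htest : ∀ a : L2 d F, IsTest a → IsH1 a := fun a ha => by
    obtain ⟨g, hg⟩ := (isTest_iff a).1 ha
    exact hg.isH1
  refine AdmissibleForm.of_bounds hlam hδ' (by positivity) ?_ ?_ ?_ ?_ ?_
  · intro a b c ha hb hc
    unfold potForm
    rw [lapPow_sub hlam hδ'.le ha hb, inner_sub_left]
  · intro a b c ha hb hc
    unfold potForm
    rw [compLp_sub, lapPow_sub hlam hδ'.le (hb.compLp S) (hc.compLp S), map_sub, inner_sub_right]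
  · intro a b ha hb
    calc _ ≤ C * ‖S‖ * (‖lapPow lam δ a‖ * (lam ^ (δ - 1 / 2) * ‖lapPow lam (1 / 2) b‖)) := by
          refine (hkey a b hb).trans ?_
          gcongr
          exact norm_lapPow_le hlam hδ'.le hb
      _ = _ := by ring
  · intro a b ha hb
    calc _ ≤ C * ‖S‖ * ((lam ^ (δ - 1 / 2) * ‖lapPow lam (1 / 2) a‖) * ‖lapPow lam δ b‖) := by
          refine (hkey a b (htest b hb)).trans ?_
          gcongr
          exact norm_lapPow_le hlam hδ'.le (htest a ha)
      _ = _ := by ring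
  · intro a b g h ha hb hd
    have hb' := hb.compLp S
    have hd' : Disjoint (tsupport g) (tsupport fun x => S (h x)) :=
      hd.mono_right (tsupport_comp_subset (map_zero S) h)
    have := hw.isSandwich a _ ha.isTest hb'.isTest
    unfold potForm
    rw [this]
    refine integral_eq_zero_of_ae ?_
    filter_upwards [ha.ae_eq, hb'.ae_eq] with x h1 h2
    rw [h1, h2, inner_eq_zero_of_disjoint hd', mul_zero, Pi.zero_apply]

theorem admissibleForm_potForm {lam : ℝ} (hlam : 0 < lam) {δ : ℝ} (hδ' : δ < 1 / 2)
    {C : ℝ} {w : X d → ℝ} (hw : SandwichBound F lam δ C w) :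
    AdmissibleForm lam δ (C * lam ^ (δ - 1 / 2) * (1 + lam ^ (δ - 1 / 2)))
      (potForm lam δ w : L2 d F → L2 d F → ℂ) := by
  have hC := hw.nonneg
  have h := admissibleForm_potForm_comp hlam hδ' hw (ContinuousLinearMap.id ℂ F)
  have hid : ∀ ψ : L2 d F, (ContinuousLinearMap.id ℂ F).compLp ψ = ψ := fun ψ =>
    Lp.ext ((ContinuousLinearMap.id ℂ F).coeFn_compLp ψ)
  simp_rw [hid] at h
  refine h.mono ?_
  gcongr
  exact mul_le_of_le_one_right hC ContinuousLinearMap.norm_id_le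

end Potential

/-! ### Divergence-free drift terms are admissible. -/

section Drift

variable {d : ℕ} {F : Type} [NormedAddCommGroup F] [InnerProductSpace ℂ F] [CompleteSpace F]

theorem VectorBound.eLpNorm_le {lam : ℝ} (hlam : 0 < lam) {δ : ℝ} (hδ' : δ < 1 / 2)
    {C : ℝ} {A : X d → EuclideanSpace ℂ (Fin d)} (hA : VectorBound F lam δ C A) {φ : L2 d F}
    (hφ : IsH1 φ) : eLpNorm (fun x => ‖A x‖ * ‖φ x‖) 2 volume ≤
      ENNReal.ofReal (C * ‖lapPow lam δ φ‖) := by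
  have h := hA.2 (lapPow lam δ φ)
  have h2 : lapPow lam (-δ) (lapPow lam δ φ) = φ := by
    rw [lapPow_eq, lapPow_eq]
    refine mult_mult (hφ.inDom_lapSym hlam hδ'.le) fun ξ => ?_
    unfold lapSym
    rw [← Complex.ofReal_mul, ← Real.rpow_add (by positivity)]
    simp
  rwa [h2] at h

/-- Cauchy–Schwarz for `‖A‖ ‖φ‖` and `‖f‖`: `φ` is the factor that absorbs `A`. A general `k` covers
inner products in either order, hence the drift before and after integration by parts. -/
theorem VectorBound.integrable_and_norm_le {lam : ℝ} (hlam : 0 < lam) {δ : ℝ} (hδ' : δ < 1 / 2)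
    {C : ℝ} (hC : 0 ≤ C) {A : X d → EuclideanSpace ℂ (Fin d)} (hA : VectorBound F lam δ C A)
    {φ : L2 d F} (hφ : IsH1 φ) (f : L2 d F) (j : Fin d) {k : X d → ℂ}
    (hk : AEStronglyMeasurable k volume) (hle : ∀ᵐ x, ‖k x‖ ≤ ‖φ x‖ * ‖f x‖) :
    Integrable (fun x => A x j * k x) volume ∧
      ‖∫ x, A x j * k x‖ ≤ C * (‖lapPow lam δ φ‖ * ‖f‖) := by
  have hb := hA.eLpNorm_le hlam hδ' hφ
  have hm : MemLp (fun x => ‖A x‖ * ‖φ x‖) 2 volume :=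
    ⟨(hA.1.norm.aestronglyMeasurable).mul (Lp.aestronglyMeasurable φ).norm,
      hb.trans_lt ENNReal.ofReal_lt_top⟩
  have hf := (Lp.memLp f).norm
  have hint : Integrable (fun x => (‖A x‖ * ‖φ x‖) * ‖f x‖) volume := hm.integrable_mul hf
  have hbd : ∀ᵐ x, ‖A x j * k x‖ ≤ (‖A x‖ * ‖φ x‖) * ‖f x‖ := by
    filter_upwards [hle] with x hx
    rw [norm_mul, mul_assoc]
    gcongr
    exact PiLp.norm_apply_le (A x) j
  have hAj : AEStronglyMeasurable (fun x => A x j) volume :=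
    ((EuclideanSpace.proj j : EuclideanSpace ℂ (Fin d) →L[ℂ] ℂ).continuous.measurable.comp
      hA.1).aestronglyMeasurable
  refine ⟨hint.mono' (hAj.mul hk) hbd, (norm_integral_le_of_norm_le hint hbd).trans ?_⟩
  have h1 : ∫ x, (‖A x‖ * ‖φ x‖) * ‖f x‖ = inner ℝ (hf.toLp _) (hm.toLp _) := by
    rw [L2.inner_def]
    refine integral_congr_ae ?_
    filter_upwards [hm.coeFn_toLp, hf.coeFn_toLp] with x h1 h2
    rw [h1, h2]
    simp
  rw [h1]
  refine (real_inner_le_norm _ _).trans ?_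
  have h2 : ‖hf.toLp _‖ = ‖f‖ := by rw [Lp.norm_toLp, eLpNorm_norm, Lp.norm_def]
  have h3 : ‖hm.toLp _‖ ≤ C * ‖lapPow lam δ φ‖ := by
    rw [Lp.norm_toLp]
    exact ENNReal.toReal_le_of_le_ofReal (by positivity) hb
  rw [h2]
  calc _ ≤ ‖f‖ * (C * ‖lapPow lam δ φ‖) := by gcongr
    _ = _ := by ring

omit [CompleteSpace F] in
theorem aestronglyMeasurable_inner (a b : L2 d F) :
    AEStronglyMeasurable (fun x => inner ℂ (a x) (b x)) volume :=
  (Lp.aestronglyMeasurable a).inner (Lp.aestronglyMeasurable b)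

/-- Integration by parts for a divergence-free vector field, on test functions. -/
theorem driftForm_eq_neg {lam : ℝ} (hlam : 0 < lam) {δ : ℝ} (hδ' : δ < 1 / 2)
    {C : ℝ} (hC : 0 ≤ C) {A : X d → EuclideanSpace ℂ (Fin d)} (hA : VectorBound F lam δ C A)
    (hdiv : DivFree A) {a b : L2 d F} {g h : X d → F} (ha : Represents g a)
    (hb : Represents h b) :
    driftForm A a b = -∑ j, ∫ x, A x j * inner ℂ (partialD j a x) (b x) := by
  have hi1 : ∀ j, Integrable (fun x => A x j * inner ℂ (a x) (partialD j b x)) volume := fun j =>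
    (hA.integrable_and_norm_le hlam hδ' hC ha.isH1 (partialD j b) j
      (aestronglyMeasurable_inner _ _) (ae_of_all _ fun x => norm_inner_le_norm _ _)).1
  have hi2 : ∀ j, Integrable (fun x => A x j * inner ℂ (partialD j a x) (b x)) volume := fun j =>
    (hA.integrable_and_norm_le hlam hδ' hC hb.isH1 (partialD j a) j
      (aestronglyMeasurable_inner _ _) (ae_of_all _ fun x => by
        rw [mul_comm]; exact norm_inner_le_norm _ _)).1
  have hcs : HasCompactSupport (fun x => inner ℂ (g x) (h x)) :=
    ha.compact.mono fun x hx => by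
      rw [Function.mem_support] at hx ⊢
      intro h0
      exact hx (by rw [h0, inner_zero_left])
  -- The product `⟨g, h⟩` is the scalar test function; its Leibniz rule produces both drift sums.
  have h0 := hdiv (fun x => inner ℂ (g x) (h x)) (ha.smooth.inner ℂ hb.smooth) hcs
  have h1 : ∫ x, ∑ j, (A x j * inner ℂ (a x) (partialD j b x) +
      A x j * inner ℂ (partialD j a x) (b x)) = 0 := by
    rw [← h0]
    refine integral_congr_ae ?_
    have hda : ∀ᵐ x, ∀ j, partialD j a x = fderiv ℝ g x (EuclideanSpace.single j 1) :=
      ae_all_iff.2 fun j => ha.partialD j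
    have hdb : ∀ᵐ x, ∀ j, partialD j b x = fderiv ℝ h x (EuclideanSpace.single j 1) :=
      ae_all_iff.2 fun j => hb.partialD j
    filter_upwards [ha.ae_eq, hb.ae_eq, hda, hdb] with x e1 e2 e3 e4
    refine Finset.sum_congr rfl fun j _ => ?_
    rw [e1, e2, e3, e4, fderiv_inner_apply ℂ (ha.smooth.differentiable (by simp) x)
      (hb.smooth.differentiable (by simp) x), mul_add]
  simp_rw [Finset.sum_add_distrib] at h1
  rw [integral_add (integrable_finsetSum _ fun j _ => hi1 j)
    (integrable_finsetSum _ fun j _ => hi2 j), integral_finsetSum _ fun j _ => hi1 j,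
    integral_finsetSum _ fun j _ => hi2 j] at h1
  exact eq_neg_of_add_eq_zero_left h1

theorem admissibleForm_driftForm {lam : ℝ} (hlam : 0 < lam) {δ : ℝ} (hδ' : δ < 1 / 2)
    {C : ℝ} (hC : 0 ≤ C) {A : X d → EuclideanSpace ℂ (Fin d)} (hA : VectorBound F lam δ C A)
    (hdiv : DivFree A) :
    AdmissibleForm lam δ (d * C * (1 + lam ^ (δ - 1 / 2)))
      (driftForm A : L2 d F → L2 d F → ℂ) := by
  have hkey := fun {a : L2 d F} (ha : IsH1 a) (f : L2 d F) (j : Fin d) =>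
    hA.integrable_and_norm_le hlam hδ' hC ha f j (aestronglyMeasurable_inner a f)
      (ae_of_all _ fun x => norm_inner_le_norm _ _)
  have hcard : ∀ t : ℝ, ∑ _j : Fin d, C * t = d * C * t := fun t => by simp; ring
  refine AdmissibleForm.of_bounds hlam hδ' (by positivity) ?_ ?_ ?_ ?_ ?_
  · intro a b c ha hb hc
    unfold driftForm
    rw [← Finset.sum_sub_distrib]
    refine Finset.sum_congr rfl fun j _ => ?_
    rw [← integral_sub (hkey ha _ j).1 (hkey hb _ j).1]
    refine integral_congr_ae ?_
    filter_upwards [Lp.coeFn_sub a b] with x hx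
    rw [hx, Pi.sub_apply, inner_sub_left, mul_sub]
  · intro a b c ha hb hc
    unfold driftForm
    rw [← Finset.sum_sub_distrib]
    refine Finset.sum_congr rfl fun j _ => ?_
    rw [← integral_sub (hkey ha _ j).1 (hkey ha _ j).1, partialD_sub j hb hc]
    refine integral_congr_ae ?_
    filter_upwards [Lp.coeFn_sub (partialD j b) (partialD j c)] with x hx
    rw [hx, Pi.sub_apply, inner_sub_right, mul_sub]
  · intro a b ha hb
    rw [← hcard]
    refine norm_sum_le_of_le _ fun j _ => ((hkey ha (partialD j b) j).2).trans ?_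
    gcongr
    exact norm_partialD_le hlam j hb
  · intro a b ha hb
    obtain ⟨g, hg⟩ := (isTest_iff a).1 ha
    obtain ⟨h, hh⟩ := (isTest_iff b).1 hb
    -- With the derivative moved to `a`, the field `A` is absorbed by `b` at order `δ`.
    rw [driftForm_eq_neg hlam hδ' hC hA hdiv hg hh, norm_neg, ← hcard]
    refine norm_sum_le_of_le _ fun j _ =>
      (hA.integrable_and_norm_le hlam hδ' hC hh.isH1 (partialD j a) j
        (aestronglyMeasurable_inner _ _) (ae_of_all _ fun x => by
          rw [mul_comm]; exact norm_inner_le_norm _ _)).2.trans ?_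
    rw [mul_comm ‖lapPow lam (1 / 2) a‖]
    gcongr
    exact norm_partialD_le hlam j hg.isH1
  · intro a b g h ha hb hd
    unfold driftForm
    refine Finset.sum_eq_zero fun j _ => integral_eq_zero_of_ae ?_
    filter_upwards [ha.ae_eq, hb.partialD j] with x h1 h2
    rw [h1, h2, Pi.zero_apply]
    by_cases hx : x ∈ tsupport h
    · rw [image_eq_zero_of_notMem_tsupport (Set.disjoint_right.1 hd hx), inner_zero_left, mul_zero]
    · rw [fderiv_of_notMem_tsupport ℝ hx, _root_.zero_apply, inner_zero_right, mul_zero]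

end Drift

/-! ### The Pauli form as a sum of admissible forms. -/

section Pauli

/-- The Pauli form is admissible, with a constant that depends only on the bounds. -/
theorem exists_admissibleForm_pauliForm (d : ℕ) {lam : ℝ} (hlam : 0 < lam) {δ : ℝ}
    (hδ' : δ < 1 / 2) {C : ℝ} (hC : 0 ≤ C) :
    ∃ K : ℝ, 0 ≤ K ∧ ∀ (W : X d → ℝ) (A : X d → EuclideanSpace ℂ (Fin d)) (B : X d → Fin 3 → ℝ),
      DivFree A → SandwichBound Spin lam δ C W → VectorBound Spin lam δ C A →
      (∀ j, SandwichBound Spin lam δ C (fun x => B x j)) →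
      AdmissibleForm lam δ K (pauliForm lam δ W A B) := by
  let S : Fin 3 → Spin →L[ℂ] Spin := fun j => Matrix.toEuclideanCLM (n := Fin 2) (𝕜 := ℂ) (pauli j)
  set c : ℝ := lam ^ (δ - 1 / 2) with hc
  have hc0 : 0 ≤ c := by positivity
  refine ⟨C * c * (1 + c) + d * C * (1 + c) +
    (Finset.univ : Finset (Fin 3)).card * (C * (∑ j, ‖S j‖) * c * (1 + c)), by positivity,
    fun W A B hdiv hW hA hB => ?_⟩
  have hBj : ∀ j : Fin 3, AdmissibleForm lam δ (C * (∑ j, ‖S j‖) * c * (1 + c))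
      (fun φ ψ : L2 d Spin => potForm lam δ (fun x => B x j) φ (pauliApply j ψ)) := fun j => by
    refine (admissibleForm_potForm_comp hlam hδ' (hB j) (S j)).mono ?_
    gcongr
    exact Finset.single_le_sum (f := fun j => ‖S j‖) (fun i _ => norm_nonneg _)
      (Finset.mem_univ j)
  exact ((admissibleForm_potForm hlam hδ' hW).add
    (admissibleForm_driftForm hlam hδ' hC hA hdiv)).add (AdmissibleForm.sum Finset.univ hBj)

end Pauli

end WeakGamma

end

theorem mainTheorem3 (d : ℕ) (hd : 0 < d) (U : X d → ℝ) (hU : AssumptionU U)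
    (lam₀ δ C : ℝ) (hlam₀ : 0 < lam₀) (hδ : 0 < δ) (hδ' : δ < 1 / 2) :
    -- Schrödinger operators on `L²(ℝ^d; ℂ)`: `V_n = W_n`
    (∀ W : ℕ∞ → X d → ℝ,
      (∀ n, SandwichBound ℂ lam₀ δ C (W n)) →
      WeakConv (F := ℂ) U (fun n => potForm lam₀ δ (W n)) →
      WeakGammaLowerBound (F := ℂ) U (fun n => potForm lam₀ δ (W n)) lam₀) ∧
    -- Pauli operators on `L²(ℝ^d; ℂ²)`: `V_n = W_n + A_n·∇ + σ·B_n`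
    (∀ (W : ℕ∞ → X d → ℝ) (A : ℕ∞ → X d → EuclideanSpace ℂ (Fin d))
        (B : ℕ∞ → X d → Fin 3 → ℝ),
      (∀ n, DivFree (A n)) →
      (∀ n, SandwichBound Spin lam₀ δ C (W n)) →
      (∀ n, VectorBound Spin lam₀ δ C (A n)) →
      (∀ n j, SandwichBound Spin lam₀ δ C (fun x => B n x j)) →
      WeakConv U (fun n => pauliForm lam₀ δ (W n) (A n) (B n)) →
      WeakGammaLowerBound U (fun n => pauliForm lam₀ δ (W n) (A n) (B n)) lam₀) := by
  constructor
  · intro W hW hconv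
    -- `C` bounds an operator norm, so it is nonnegative.
    have hC := (hW ⊤).nonneg
    exact weakGammaLowerBound_of_admissible hU hlam₀ hδ hδ' (by positivity)
      (fun n => admissibleForm_potForm hlam₀ hδ' (hW n)) hconv
  · intro W A B hdiv hW hA hB hconv
    obtain ⟨K, hK0, hK⟩ := exists_admissibleForm_pauliForm d hlam₀ hδ' (hW ⊤).nonneg
    exact weakGammaLowerBound_of_admissible hU hlam₀ hδ hδ' hK0
      (fun n => hK (W n) (A n) (B n) (hdiv n) (hW n) (hA n) (hB n)) hconv
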